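/- Let $(M,g)$ be a Riemannian manifold with Levi-Civita connection $\nabla$. On $TM$-valued differential forms put $$(\nabla_X\omega)(X_1,\dots,X_p)=\nabla_X\big(\omega(X_1,\dots,X_p)\big)-\sum_{s=1}^p\omega(X_1,\dots,\nabla_XX_s,\dots,X_p),$$ $$d\omega(X_0,\dots,X_p)=\sum_{s=0}^p(-1)^s(\nabla_{X_s}\omega)(X_0,\dots,\widehat{X_s},\dots,X_p),\qquad \delta\omega(X_1,\dots,X_{p-1})=-\sum_i(\nabla_{e_i}\omega)(e_i,X_1,\dots,X_{p-1}),$$ where $\{e_i\}$ is a local orthonormal frame, and $\Delta=d\delta+\delta d$. An almost complex structure on $M$ is a smooth section $J$ of $\mathrm{Hom}(TM,TM)=T^*M\otimes TM$ with $J^2=-\mathrm{id}$; it is not assumed to be compatible with $g$. It is called a *harmonic complex structure* with respect to $g$ if, as a $TM$-valued $1$-form, it satisfies $\Delta J=0$. **Theorem 4.2.** Let $g_0$ be the standard round metric on the unit sphere $S^6\subset\mathbb R^7$. 1. $(S^6,g_0)$ admits no harmonic complex structure. 2. The same holds for small perturbations of $g_0$: there is $\varepsilon>0$ such that, for every smooth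 Riemannian metric $g$ on $S^6$ with $\|g-g_0\|_{C^2}<\varepsilon$, there is no harmonic complex structure on $S^6$ with respect to $g$. Here $\|h\|_{C^2}$ is the largest value, over all $q\in S^6$, of the components of $h$ and of the norms of their first and second derivatives at $q$, in the coordinates given by stereographic projection from $-q$. -/

import Mathlib

open scoped Manifold ContDiff Bundle
open Bundle

noncomputable section

/-! ### Tensor calculus of `TM`-valued forms in a coordinate chart

Throughout, `G x` is the matrix `(g_ij (x))` of a Riemannian metric in a coordinate chart, with
coordinates `x ∈ ℝⁿ`, and `∂₁, …, ∂ₙ` is the coordinate frame. -/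

namespace ChartCalculus

variable {n : ℕ}

/-- The partial derivative `∂f / ∂xᵃ`. -/
def partialDeriv (a : Fin n) (f : EuclideanSpace ℝ (Fin n) → ℝ)
    (x : EuclideanSpace ℝ (Fin n)) : ℝ :=
  fderiv ℝ f x (EuclideanSpace.single a 1)

/-- The Christoffel symbols of the Levi-Civita connection,
`Γᵏ_ij = ½ ∑ₗ gᵏˡ (∂ᵢ g_jl + ∂ⱼ g_il - ∂ₗ g_ij)`, so that `∇_{∂ᵢ} ∂ⱼ = ∑ₖ Γᵏ_ij ∂ₖ`. -/
def christoffel (G : EuclideanSpace ℝ (Fin n) → Matrix (Fin n) (Fin n) ℝ) (k i j : Fin n)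
    (x : EuclideanSpace ℝ (Fin n)) : ℝ :=
  (1 / 2) * ∑ l, (G x)⁻¹ k l *
    (partialDeriv i (fun y => G y j l) x + partialDeriv j (fun y => G y i l) x
      - partialDeriv l (fun y => G y i j) x)

/-- A `TM`-valued `p`-form `θ` in a chart, through its components:
`θ(∂_{i₁}, …, ∂_{i_p}) = ∑ₖ (θ i k) ∂ₖ`. -/
abbrev VForm (n p : ℕ) := (Fin p → Fin n) → Fin n → EuclideanSpace ℝ (Fin n) → ℝ

variable {p : ℕ}

/-- The `k`-th component of `(∇_{∂ₐ} θ)(∂_{i₁}, …, ∂_{i_p})`, where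
`(∇_X θ)(X₁, …, X_p) = ∇_X (θ(X₁, …, X_p)) - ∑ₛ θ(X₁, …, ∇_X Xₛ, …, X_p)`. -/
def covDeriv (G : EuclideanSpace ℝ (Fin n) → Matrix (Fin n) (Fin n) ℝ) (θ : VForm n p)
    (a : Fin n) : VForm n p := fun i k x =>
  partialDeriv a (θ i k) x + ∑ l, christoffel G k a l x * θ i l x
    - ∑ s : Fin p, ∑ l, christoffel G l a (i s) x * θ (Function.update i s l) k x

/-- `dθ(X₀, …, X_p) = ∑ₛ (-1)ˢ (∇_{Xₛ} θ)(X₀, …, X̂ₛ, …, X_p)`. -/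
def extD (G : EuclideanSpace ℝ (Fin n) → Matrix (Fin n) (Fin n) ℝ) (θ : VForm n p) :
    VForm n (p + 1) := fun i k x =>
  ∑ s : Fin (p + 1), (-1 : ℝ) ^ (s : ℕ) * covDeriv G θ (i s) (fun r => i (s.succAbove r)) k x

/-- `δθ(X₁, …, X_p) = -∑ₑ (∇ₑ θ)(e, X₁, …, X_p)`, the sum being over a `g`-orthonormal frame,
i.e. the contraction with `gᵃᵇ` in terms of the coordinate frame. -/
def codiff (G : EuclideanSpace ℝ (Fin n) → Matrix (Fin n) (Fin n) ℝ) (θ : VForm n (p + 1)) :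
    VForm n p := fun i k x =>
  -∑ a, ∑ b, (G x)⁻¹ a b * covDeriv G θ a (Fin.cons b i) k x

/-- The Hodge-Laplace operator `Δ = dδ + δd` on `TM`-valued forms of degree `p + 1 ≥ 1`. -/
def hodgeLaplace (G : EuclideanSpace ℝ (Fin n) → Matrix (Fin n) (Fin n) ℝ)
    (θ : VForm n (p + 1)) : VForm n (p + 1) := fun i k x =>
  extD G (codiff G θ) i k x + codiff G (extD G θ) i k x

end ChartCalculus

/-! ### Riemannian metrics and almost complex structures on a manifold -/

section Manifold

variable {n : ℕ} {M : Type*} [TopologicalSpace M]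
  [ChartedSpace (EuclideanSpace ℝ (Fin n)) M] [IsManifold (𝓡 n) ∞ M]

/-- A smooth Riemannian metric on `M`. -/
abbrev SmoothMetric (n : ℕ) (M : Type*) [TopologicalSpace M]
    [ChartedSpace (EuclideanSpace ℝ (Fin n)) M] [IsManifold (𝓡 n) ∞ M] :=
  ContMDiffRiemannianMetric (𝓡 n) ∞ (EuclideanSpace ℝ (Fin n))
    (fun p : M => TangentSpace (𝓡 n) p)

/-- An almost complex structure on `M`: a smooth section `J` of `Hom(TM, TM)` with `J² = -id`.
No compatibility with a metric is required. -/
structure AlmostComplexStructure (n : ℕ) (M : Type*) [TopologicalSpace M]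
    [ChartedSpace (EuclideanSpace ℝ (Fin n)) M] [IsManifold (𝓡 n) ∞ M] where
  /-- the endomorphism of each tangent space -/
  toFun (p : M) : TangentSpace (𝓡 n) p →L[ℝ] TangentSpace (𝓡 n) p
  contMDiff : ContMDiff (𝓡 n)
    ((𝓡 n).prod 𝓘(ℝ, EuclideanSpace ℝ (Fin n) →L[ℝ] EuclideanSpace ℝ (Fin n))) ∞
    (fun p => TotalSpace.mk' (EuclideanSpace ℝ (Fin n) →L[ℝ] EuclideanSpace ℝ (Fin n))
      (E := fun p : M => TangentSpace (𝓡 n) p →L[ℝ] TangentSpace (𝓡 n) p) p (toFun p))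
  sq (p : M) (v : TangentSpace (𝓡 n) p) : toFun p (toFun p v) = -v

/-- The coordinate vector field `∂ᵢ` of the chart at `q`, at the point with coordinates `x`. -/
def coordVec (q : M) (i : Fin n) (x : EuclideanSpace ℝ (Fin n)) :
    TangentSpace (𝓡 n) ((extChartAt (𝓡 n) q).symm x) :=
  mfderiv 𝓘(ℝ, EuclideanSpace ℝ (Fin n)) (𝓡 n) (extChartAt (𝓡 n) q).symm x
    (EuclideanSpace.single i (1 : ℝ) : EuclideanSpace ℝ (Fin n))

/-- The matrix `g_ij = g(∂ᵢ, ∂ⱼ)` of the metric in the chart at `q`. -/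
def metricCoord (g : SmoothMetric n M) (q : M) (x : EuclideanSpace ℝ (Fin n)) :
    Matrix (Fin n) (Fin n) ℝ :=
  Matrix.of fun i j =>
    g.inner ((extChartAt (𝓡 n) q).symm x) (coordVec q i x) (coordVec q j x)

/-- The `TM`-valued 1-form `J` in the chart at `q`: `J ∂ᵢ = ∑ₖ Jᵏᵢ ∂ₖ`, where
`Jᵏᵢ = dxᵏ (J ∂ᵢ)`. -/
def structureCoord (J : AlmostComplexStructure n M) (q : M) : ChartCalculus.VForm n 1 :=
  fun i k x =>
    mvfderiv (𝓡 n) (extChartAt (𝓡 n) q) ((extChartAt (𝓡 n) q).symm x)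
      (J.toFun ((extChartAt (𝓡 n) q).symm x) (coordVec q (i 0) x)) k

/-- `J` is a harmonic complex structure with respect to `g`: `ΔJ = 0` at every point `q` of `M`,
where `ΔJ` is the Hodge-Laplacian of `J` as a `TM`-valued 1-form, computed at `q` in the preferred
chart around `q`. (`ΔJ` is a tensor, so the choice of the chart is immaterial.) -/
def IsHarmonicComplexStructure (g : SmoothMetric n M) (J : AlmostComplexStructure n M) : Prop :=
  ∀ (q : M) (i : Fin 1 → Fin n) (k : Fin n),
    ChartCalculus.hodgeLaplace (metricCoord g q) (structureCoord J q) i k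
      (extChartAt (𝓡 n) q q) = 0

end Manifold

/-! ### The round sphere -/

/-- The unit sphere `Sⁿ` in `ℝⁿ⁺¹`. -/
abbrev UnitSphere (n : ℕ) := Metric.sphere (0 : EuclideanSpace ℝ (Fin (n + 1))) 1

/-- The differential at `p` of the inclusion `Sⁿ ⊂ ℝⁿ⁺¹`. -/
def sphereInclDeriv (n : ℕ) (p : UnitSphere n) :
    TangentSpace (𝓡 n) p →L[ℝ] EuclideanSpace ℝ (Fin (n + 1)) :=
  mvfderiv (𝓡 n) (Subtype.val : UnitSphere n → EuclideanSpace ℝ (Fin (n + 1))) p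

/-- The inner product on `T_p Sⁿ` induced by the Euclidean inner product of `ℝⁿ⁺¹`. -/
def roundInner (n : ℕ) (p : UnitSphere n) :
    TangentSpace (𝓡 n) p →L[ℝ] TangentSpace (𝓡 n) p →L[ℝ] ℝ :=
  (ContinuousLinearMap.precomp ℝ (sphereInclDeriv n p)) ∘L
    (innerSL ℝ : EuclideanSpace ℝ (Fin (n + 1)) →L[ℝ] EuclideanSpace ℝ (Fin (n + 1)) →L[ℝ] ℝ) ∘L
    (sphereInclDeriv n p)

theorem roundInner_apply (n : ℕ) (p : UnitSphere n) (v w : TangentSpace (𝓡 n) p) :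
    roundInner n p v w = inner ℝ (sphereInclDeriv n p v) (sphereInclDeriv n p w) := rfl

theorem sphereInclDeriv_injective (n : ℕ) (p : UnitSphere n) :
    Function.Injective (sphereInclDeriv n p) :=
  have := Fact.mk (@finrank_euclideanSpace_fin ℝ _ (n + 1))
  injective_mvfderiv_subtypeVal_sphere p

theorem roundInner_isVonNBounded (n : ℕ) (p : UnitSphere n) :
    Bornology.IsVonNBounded ℝ {v : TangentSpace (𝓡 n) p | roundInner n p v v < 1} := by
  change Bornology.IsVonNBounded ℝ {v : EuclideanSpace ℝ (Fin n) | roundInner n p v v < 1}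
  rw [NormedSpace.isVonNBounded_iff]
  let L : EuclideanSpace ℝ (Fin n) →L[ℝ] EuclideanSpace ℝ (Fin (n + 1)) := sphereInclDeriv n p
  have hL : Function.Injective L := sphereInclDeriv_injective n p
  obtain ⟨K, -, hK⟩ := L.exists_antilipschitzWith (LinearMap.ker_eq_bot.2 hL)
  have : Bornology.IsBounded (L ⁻¹' Metric.ball 0 1) := hK.isBounded_preimage Metric.isBounded_ball
  refine this.subset fun v hv => ?_
  have hv' : inner ℝ (L v) (L v) < (1 : ℝ) := hv
  rw [real_inner_self_eq_norm_sq] at hv'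
  simp only [Set.mem_preimage, mem_ball_zero_iff]
  nlinarith [norm_nonneg (L v)]

theorem roundInner_contMDiff (n : ℕ) :
    ContMDiff (𝓡 n)
      ((𝓡 n).prod 𝓘(ℝ, EuclideanSpace ℝ (Fin n) →L[ℝ] EuclideanSpace ℝ (Fin n) →L[ℝ] ℝ)) ∞
      (fun p => TotalSpace.mk'
        (EuclideanSpace ℝ (Fin n) →L[ℝ] EuclideanSpace ℝ (Fin n) →L[ℝ] ℝ)
        (E := fun p : UnitSphere n =>
          TangentSpace (𝓡 n) p →L[ℝ] TangentSpace (𝓡 n) p →L[ℝ] ℝ) p (roundInner n p)) := by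
  have := Fact.mk (@finrank_euclideanSpace_fin ℝ _ (n + 1))
  intro p
  rw [contMDiffAt_section]
  have h1 := ContMDiffAt.mfderiv_const (m := ∞) (n := ∞) (x₀ := p)
    ((contMDiff_coe_sphere (E := EuclideanSpace ℝ (Fin (n + 1))) (n := n)).contMDiffAt) le_rfl
  set D := inTangentCoordinates (𝓡 n) 𝓘(ℝ, EuclideanSpace ℝ (Fin (n + 1))) id
    (Subtype.val : UnitSphere n → EuclideanSpace ℝ (Fin (n + 1)))
    (mfderiv (𝓡 n) 𝓘(ℝ, EuclideanSpace ℝ (Fin (n + 1))) Subtype.val) p with hD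
  have h2 : ContMDiffAt (𝓡 n)
      𝓘(ℝ, EuclideanSpace ℝ (Fin n) →L[ℝ] EuclideanSpace ℝ (Fin n) →L[ℝ] ℝ) ∞
      (fun b => ((ContinuousLinearMap.compL ℝ (EuclideanSpace ℝ (Fin n))
        (EuclideanSpace ℝ (Fin (n + 1))) ℝ).flip (D b)) ∘L
        ((innerSL ℝ : EuclideanSpace ℝ (Fin (n + 1)) →L[ℝ]
          EuclideanSpace ℝ (Fin (n + 1)) →L[ℝ] ℝ) ∘L (D b))) p :=
    ((ContinuousLinearMap.contMDiff _).contMDiffAt.comp p h1).clm_comp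
      (contMDiffAt_const.clm_comp h1)
  refine h2.congr_of_eventuallyEq ?_
  filter_upwards [(trivializationAt (EuclideanSpace ℝ (Fin n))
    (TangentSpace (𝓡 n) : UnitSphere n → Type) p).open_baseSet.mem_nhds
    (FiberBundle.mem_baseSet_trivializationAt' p)] with b hb
  ext v w
  have hb' : b ∈ (trivializationAt (EuclideanSpace ℝ (Fin n) →L[ℝ] ℝ)
      (fun x : UnitSphere n => TangentSpace (𝓡 n) x →L[ℝ] ℝ) p).baseSet := by
    simpa [hom_trivializationAt_baseSet] using hb
  have hDb (u : EuclideanSpace ℝ (Fin n)) : D b u = sphereInclDeriv n b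
      ((trivializationAt (EuclideanSpace ℝ (Fin n))
        (TangentSpace (𝓡 n) : UnitSphere n → Type) p).symmL ℝ b u) := by
    simp only [D, inTangentCoordinates, ContinuousLinearMap.inCoordinates,
      TangentBundle.continuousLinearMapAt_model_space]
    rfl
  have hrhs : (((ContinuousLinearMap.compL ℝ (EuclideanSpace ℝ (Fin n))
        (EuclideanSpace ℝ (Fin (n + 1))) ℝ).flip (D b)) ∘L
        ((innerSL ℝ : EuclideanSpace ℝ (Fin (n + 1)) →L[ℝ]
          EuclideanSpace ℝ (Fin (n + 1)) →L[ℝ] ℝ) ∘L (D b))) v w = inner ℝ (D b v) (D b w) := rfl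
  rw [hrhs, hDb, hDb, ← roundInner_apply]
  simp only [hom_trivializationAt_apply, ContinuousLinearMap.inCoordinates,
    ContinuousLinearMap.coe_comp, Function.comp_apply,
    Trivialization.continuousLinearMapAt_apply, Trivialization.coe_linearMapAt_of_mem _ hb']
  simp

/-- The standard round metric on `Sⁿ`. -/
def roundMetric (n : ℕ) : SmoothMetric n (UnitSphere n) where
  inner := roundInner n
  symm p v w := by
    rw [roundInner_apply, roundInner_apply, real_inner_comm]
  pos p v hv := by
    rw [roundInner_apply]
    refine real_inner_self_pos.2 fun h => hv ?_
    exact sphereInclDeriv_injective n p (h.trans (map_zero (sphereInclDeriv n p)).symm)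
  isVonNBounded := roundInner_isVonNBounded n
  contMDiff := roundInner_contMDiff n

/-- `g` lies in the `C²`-ball of radius `ε` around the round metric: at each `q`, the components of
`g - g_round` in the chart at `q` (the stereographic projection that sends `q` to the origin)
and their derivatives of order at most `2` are smaller than `ε` at `q`. Since these charts are
carried to one another by isometries of the round sphere, this is a ball of a norm that defines the
usual `C²`-topology on symmetric 2-tensors on `Sⁿ`. -/
def IsC2CloseToRound {n : ℕ} (ε : ℝ) (g : SmoothMetric n (UnitSphere n)) : Prop :=
  ∀ (q : UnitSphere n) (i j : Fin n), ∀ m ≤ 2,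
    ‖iteratedFDeriv ℝ m (fun x => metricCoord g q x i j - metricCoord (roundMetric n) q x i j)
      (extChartAt (𝓡 n) q q)‖ < ε

end

/-! The proof is a pointwise Bochner argument: a maximum principle replaces integration. In any
chart the second-order part of `Δ` on `TM`-valued 1-forms is `-gᵃᵇ∂ₐ∂_b` acting on each component,
because the mixed second derivatives in `dδ` and `δd` cancel (`hodgeLaplace_one`). The rest depends
linearly on the 1-jet `(A, P)` of the form, with coefficients polynomial in `g⁻¹`, `∂g` and `∂∂g`.

Let `|J|²` be the squared norm of `J` for the round metric, even when `ΔJ` is taken with respect to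
another metric `g`. It attains a maximum at some `q`. Stereographic charts are conformal and `J` has
one lower and one upper index, so the conformal factors cancel and `|J|²` is the sum of the squares
of the components of `J` in every such chart. Let the chart be centred at `q`. At its origin the
contraction of `g⁻¹` with the Hessian of `|J|²` is nonpositive. If `ΔJ = 0`, the second derivatives
of `J` can be replaced by terms of order at most one, and the same contraction becomes twice a
quadratic form in the 1-jet of `J`.

For the round metric this form is `|P|² + (n-1)|A|² + ∑ Aᵢₖ Aₖᵢ - (tr A)²`. Since `J² = -1` forces
`tr J = 0`, `bochnerForm` may add `(tr A)²` without changing the value at `J`; the sum is positive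
definite on all 1-jets when `n ≥ 3` (`bochnerForm_roundJet_pos`). As `J` does not vanish, this
contradicts the sign of the Hessian (`exists_hodgeLaplace_ne_zero`).

Positive definiteness on a finite-dimensional space is an open condition on the 2-jet of the metric
(`eventually_bochnerForm_pos`). The round metric has the same 2-jet at the centre of each
stereographic chart, so one `ε` serves all points of the sphere. -/

noncomputable section

namespace ChartCalculus

variable {n : ℕ}

/-! ### The pointwise Bochner form -/

/-- First derivatives of the inverse of a matrix function with inverse `H` and derivatives `g₁`. -/
def invDeriv (H : Fin n → Fin n → ℝ) (g₁ : Fin n → Fin n → Fin n → ℝ) (c a b : Fin n) : ℝ :=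
  -∑ k, ∑ l, H a k * g₁ c k l * H l b

/-- The Christoffel symbols in terms of the inverse metric and the first derivatives of the
metric. -/
def christoffelJet (H : Fin n → Fin n → ℝ) (g₁ : Fin n → Fin n → Fin n → ℝ) (k i j : Fin n) : ℝ :=
  (1 / 2) * ∑ l, H k l * (g₁ i j l + g₁ j i l - g₁ l i j)

/-- The derivatives `∂ₐ Γᵏ_ij` in terms of the inverse metric and the derivatives of the metric. -/
def christoffelDerivJet (H : Fin n → Fin n → ℝ) (g₁ : Fin n → Fin n → Fin n → ℝ)
    (g₂ : Fin n → Fin n → Fin n → Fin n → ℝ) (a k i j : Fin n) : ℝ :=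
  (1 / 2) * ∑ l, (invDeriv H g₁ a k l * (g₁ i j l + g₁ j i l - g₁ l i j)
    + H k l * (g₂ a i j l + g₂ a j i l - g₂ a l i j))

/-- `(∇_{∂ₐ} θ)(∂ᵢ)` for a 1-form `θ` with components `A` and derivatives `P`. -/
def covJet (Γ : Fin n → Fin n → Fin n → ℝ) (A : Fin n → Fin n → ℝ)
    (P : Fin n → Fin n → Fin n → ℝ) (a i k : Fin n) : ℝ :=
  P a i k + ∑ l, Γ k a l * A i l - ∑ l, Γ l a i * A l k

/-- The derivative in the direction `∂_c` of the components of `∇ θ` for a 1-form `θ`. -/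
def covDerivJet (Γ : Fin n → Fin n → Fin n → ℝ) (dΓ : Fin n → Fin n → Fin n → Fin n → ℝ)
    (A : Fin n → Fin n → ℝ) (P : Fin n → Fin n → Fin n → ℝ)
    (S : Fin n → Fin n → Fin n → Fin n → ℝ) (c a i k : Fin n) : ℝ :=
  S c a i k + ∑ l, (dΓ c k a l * A i l + Γ k a l * P c i l)
    - ∑ l, (dΓ c l a i * A l k + Γ l a i * P c l k)

/-- The Hodge-Laplacian of a 1-form at a point, in terms of the inverse metric `H`, its first
derivatives, the Christoffel symbols and their first derivatives, and the 2-jet `A, P, S` of the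
form. -/
def laplaceJet (H : Fin n → Fin n → ℝ) (dH Γ : Fin n → Fin n → Fin n → ℝ)
    (dΓ : Fin n → Fin n → Fin n → Fin n → ℝ)
    (A : Fin n → Fin n → ℝ) (P : Fin n → Fin n → Fin n → ℝ)
    (S : Fin n → Fin n → Fin n → Fin n → ℝ) (i k : Fin n) : ℝ :=
  (-∑ a, ∑ b, (dH i a b * covJet Γ A P a b k + H a b * covDerivJet Γ dΓ A P S i a b k)
    + ∑ l, Γ k i l * (-∑ a, ∑ b, H a b * covJet Γ A P a b l))
  + -∑ a, ∑ b, H a b * ((covDerivJet Γ dΓ A P S a b i k - covDerivJet Γ dΓ A P S a i b k)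
      + ∑ l, Γ k a l * (covJet Γ A P b i l - covJet Γ A P i b l)
      - (∑ l, Γ l a b * (covJet Γ A P l i k - covJet Γ A P i l k)
        + ∑ l, Γ l a i * (covJet Γ A P b l k - covJet Γ A P l b k)))

theorem covDerivJet_eq_add (Γ : Fin n → Fin n → Fin n → ℝ)
    (dΓ : Fin n → Fin n → Fin n → Fin n → ℝ) (A : Fin n → Fin n → ℝ)
    (P : Fin n → Fin n → Fin n → ℝ) (S : Fin n → Fin n → Fin n → Fin n → ℝ) (c a i k : Fin n) :
    covDerivJet Γ dΓ A P S c a i k = S c a i k + covDerivJet Γ dΓ A P 0 c a i k := by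
  simp only [covDerivJet, Pi.zero_apply]
  ring

/-- The second derivatives enter the Hodge-Laplacian only through `-∑ Hᵃᵇ ∂ₐ∂_b`. -/
theorem laplaceJet_eq_add (H : Fin n → Fin n → ℝ) (dH Γ : Fin n → Fin n → Fin n → ℝ)
    (dΓ : Fin n → Fin n → Fin n → Fin n → ℝ)
    (A : Fin n → Fin n → ℝ) (P : Fin n → Fin n → Fin n → ℝ)
    (S : Fin n → Fin n → Fin n → Fin n → ℝ) (hS : ∀ a b i k, S a b i k = S b a i k)
    (i k : Fin n) :
    laplaceJet H dH Γ dΓ A P S i k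
      = -∑ a, ∑ b, H a b * S a b i k + laplaceJet H dH Γ dΓ A P 0 i k := by
  simp only [laplaceJet]
  rw [add_assoc, add_assoc, ← sub_eq_zero]
  -- Symmetry turns the mixed term `-Hᵃᵇ S i a b k` of `dδ` into the opposite of the term `Hᵃᵇ S a i
  -- b k` of `δd`.
  simp only [covDerivJet_eq_add Γ dΓ A P S, hS i]
  simp only [mul_add, mul_sub, Finset.sum_add_distrib, Finset.sum_sub_distrib]
  ring

theorem covJet_smul (Γ : Fin n → Fin n → Fin n → ℝ) (A : Fin n → Fin n → ℝ)
    (P : Fin n → Fin n → Fin n → ℝ) (c : ℝ) (a i k : Fin n) :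
    covJet Γ (c • A) (c • P) a i k = c * covJet Γ A P a i k := by
  simp only [covJet, Pi.smul_apply, smul_eq_mul, mul_add, mul_sub, Finset.mul_sum,
    mul_left_comm]

theorem covDerivJet_smul (Γ : Fin n → Fin n → Fin n → ℝ)
    (dΓ : Fin n → Fin n → Fin n → Fin n → ℝ) (A : Fin n → Fin n → ℝ)
    (P : Fin n → Fin n → Fin n → ℝ) (c : ℝ) (b a i k : Fin n) :
    covDerivJet Γ dΓ (c • A) (c • P) 0 b a i k = c * covDerivJet Γ dΓ A P 0 b a i k := by
  simp only [covDerivJet, Pi.smul_apply, Pi.zero_apply, smul_eq_mul, mul_add, mul_sub,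
    Finset.mul_sum, mul_left_comm, mul_zero]

theorem laplaceJet_smul (H : Fin n → Fin n → ℝ) (dH Γ : Fin n → Fin n → Fin n → ℝ)
    (dΓ : Fin n → Fin n → Fin n → Fin n → ℝ) (A : Fin n → Fin n → ℝ)
    (P : Fin n → Fin n → Fin n → ℝ) (c : ℝ) (i k : Fin n) :
    laplaceJet H dH Γ dΓ (c • A) (c • P) 0 i k = c * laplaceJet H dH Γ dΓ A P 0 i k := by
  simp only [laplaceJet, covJet_smul, covDerivJet_smul, mul_add, mul_sub, mul_neg,
    Finset.mul_sum, mul_left_comm c]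

/-- The inverse metric at a point, together with the first and second derivatives of the metric. -/
abbrev MetricJet (n : ℕ) : Type :=
  (Fin n → Fin n → ℝ) × (Fin n → Fin n → Fin n → ℝ) × (Fin n → Fin n → Fin n → Fin n → ℝ)

/-- The 1-jet at a point of a `TM`-valued 1-form. -/
abbrev FormJet (n : ℕ) : Type := (Fin n → Fin n → ℝ) × (Fin n → Fin n → Fin n → ℝ)

/-- The part of order at most one of the Hodge-Laplacian on `TM`-valued 1-forms. -/
def lowerLaplace (t : MetricJet n) (u : FormJet n) (i k : Fin n) : ℝ :=
  laplaceJet t.1 (invDeriv t.1 t.2.1) (christoffelJet t.1 t.2.1)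
    (christoffelDerivJet t.1 t.2.1 t.2.2) u.1 u.2 0 i k

/-- The quadratic form on 1-jets of `TM`-valued 1-forms that the Bochner argument needs to be
positive. -/
def bochnerForm (t : MetricJet n) (u : FormJet n) : ℝ :=
  ∑ a, ∑ b, t.1 a b * ∑ i, ∑ k, u.2 a i k * u.2 b i k
    + ∑ i, ∑ k, u.1 i k * lowerLaplace t u i k + (∑ i, u.1 i i) ^ 2

/-- The form is a polynomial in all the variables: the jet records the inverse metric itself, so
nothing is divided. -/
theorem continuous_bochnerForm :
    Continuous fun z : MetricJet n × FormJet n => bochnerForm z.1 z.2 := by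
  unfold bochnerForm lowerLaplace laplaceJet covDerivJet covJet christoffelDerivJet
    christoffelJet invDeriv
  fun_prop

/-- Homogeneity reduces positivity for all nonzero jets to positivity on the compact unit sphere of
jets. -/
theorem bochnerForm_smul (t : MetricJet n) (u : FormJet n) (c : ℝ) :
    bochnerForm t (c • u) = c ^ 2 * bochnerForm t u := by
  have h1 : ∀ i k, lowerLaplace t (c • u) i k = c * lowerLaplace t u i k := fun i k =>
    laplaceJet_smul _ _ _ _ _ _ _ _ _
  simp only [bochnerForm, h1, Prod.smul_fst, Prod.smul_snd, Pi.smul_apply, smul_eq_mul,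
    ← Finset.mul_sum, mul_add, mul_pow]
  simp only [Finset.mul_sum]
  congr 2
  · refine Finset.sum_congr rfl fun a _ => Finset.sum_congr rfl fun b _ =>
      Finset.sum_congr rfl fun i _ => Finset.sum_congr rfl fun k _ => by ring
  · refine Finset.sum_congr rfl fun a _ => Finset.sum_congr rfl fun b _ => by ring

/-- The jet at the origin of the round metric in a stereographic chart. -/
def roundJet (n : ℕ) : MetricJet n :=
  (fun i j => if i = j then 1 else 0, 0,
    fun a b i j => if a = b then if i = j then -1 else 0 else 0)

theorem christoffelJet_roundJet : christoffelJet (roundJet n).1 (roundJet n).2.1 = 0 := by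
  funext k i j
  simp [christoffelJet, roundJet]

theorem invDeriv_roundJet : invDeriv (roundJet n).1 (roundJet n).2.1 = 0 := by
  funext k i j
  simp [invDeriv, roundJet]

/-- The first derivatives of the metric vanish at the centre, so only `∂ₐ∂_b g_ij = -δ_ab δ_ij`
contributes. -/
theorem christoffelDerivJet_roundJet (a k i j : Fin n) :
    christoffelDerivJet (roundJet n).1 (roundJet n).2.1 (roundJet n).2.2 a k i j
      = (1 / 2) * (-(if a = i then if j = k then 1 else 0 else 0)
        - (if a = j then if i = k then 1 else 0 else 0)
        + (if a = k then if i = j then 1 else 0 else 0)) := by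
  rw [christoffelDerivJet, invDeriv_roundJet]
  simp only [roundJet, Pi.zero_apply, zero_mul, zero_add, ite_mul, one_mul,
    Finset.sum_ite_eq, Finset.mem_univ, if_true]
  split_ifs <;> simp_all

/-- The curvature term of the Hodge-Laplacian of the round sphere. -/
theorem lowerLaplace_roundJet (u : FormJet n) (i k : Fin n) :
    lowerLaplace (roundJet n) u i k
      = ((n : ℝ) - 1) * u.1 i k + u.1 k i - (if i = k then ∑ j, u.1 j j else 0) := by
  -- With `Γ = 0` and `∂g⁻¹ = 0` the only surviving terms are products of `∂Γ` with `A`; the first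
  -- derivatives `P` drop out.
  rw [lowerLaplace, christoffelJet_roundJet, invDeriv_roundJet, laplaceJet]
  simp only [covDerivJet, christoffelDerivJet_roundJet, Pi.zero_apply, zero_mul, zero_add,
    add_zero, Finset.sum_const_zero, sub_zero]
  simp only [roundJet, ite_mul, one_mul, zero_mul, Finset.sum_ite_eq, Finset.mem_univ, if_true]
  simp only [mul_add, add_mul, mul_sub, sub_mul, mul_neg, neg_mul, mul_ite, ite_mul, mul_one,
    mul_zero, zero_mul,
    Finset.sum_add_distrib, Finset.sum_sub_distrib, Finset.sum_neg_distrib,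
    Finset.sum_ite_eq, Finset.sum_ite_eq', Finset.mem_univ, if_true]
  simp only [Finset.sum_ite_irrel, Finset.sum_const_zero, Finset.sum_ite_eq, Finset.sum_ite_eq',
    Finset.mem_univ, if_true, Finset.sum_const, Finset.card_univ, Fintype.card_fin, nsmul_eq_mul,
    ← Finset.mul_sum]
  split_ifs <;> ring

/-- The added `(tr A)²` cancels the negative trace term of the curvature. The indefinite term `∑ Aᵢₖ
Aₖᵢ` is at least `-|A|²`, which `(n-1)|A|²` outweighs by at least `|A|²` once `n ≥ 3`. -/
theorem bochnerForm_roundJet_pos (hn : 3 ≤ n) (u : FormJet n) (hu : u ≠ 0) :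
    0 < bochnerForm (roundJet n) u := by
  have hn' : (3 : ℝ) ≤ n := by exact_mod_cast hn
  have hP : ∑ a, ∑ b, (roundJet n).1 a b * ∑ i, ∑ k, u.2 a i k * u.2 b i k
      = ∑ a, ∑ i, ∑ k, u.2 a i k ^ 2 := by
    simp [roundJet, sq]
  have hA : ∑ i, ∑ k, u.1 i k * lowerLaplace (roundJet n) u i k + (∑ i, u.1 i i) ^ 2
      = ∑ i, ∑ k, (((n : ℝ) - 1) * u.1 i k ^ 2 + u.1 i k * u.1 k i) := by
    simp only [lowerLaplace_roundJet, mul_sub, Finset.sum_sub_distrib, mul_ite, mul_zero,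
      Finset.sum_ite_eq, Finset.mem_univ, if_true, ← Finset.sum_mul, sq, sub_add_cancel]
    refine Finset.sum_congr rfl fun a _ => Finset.sum_congr rfl fun b _ => by ring
  have hB : ∑ i, ∑ k, u.1 i k ^ 2
      ≤ ∑ i, ∑ k, (((n : ℝ) - 1) * u.1 i k ^ 2 + u.1 i k * u.1 k i) := by
    have h1 : ∑ i, ∑ k, u.1 k i ^ 2 = ∑ i, ∑ k, u.1 i k ^ 2 := Finset.sum_comm
    -- The termwise difference of the two sides is `(n-3) Aᵢₖ² + ½ (Aᵢₖ + Aₖᵢ)²`; after summation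
    -- the left side is `|A|²`.
    have h2 : ∑ i, ∑ k, ((3 / 2) * u.1 i k ^ 2 - (1 / 2) * u.1 k i ^ 2)
        ≤ ∑ i, ∑ k, (((n : ℝ) - 1) * u.1 i k ^ 2 + u.1 i k * u.1 k i) :=
      Finset.sum_le_sum fun i _ => Finset.sum_le_sum fun k _ => by
        nlinarith [sq_nonneg (u.1 i k + u.1 k i),
          mul_nonneg (sub_nonneg.2 hn') (sq_nonneg (u.1 i k))]
    simp only [Finset.sum_sub_distrib, ← Finset.mul_sum, h1] at h2
    linarith
  rw [bochnerForm, add_assoc, hA, hP]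
  have hP0 : 0 ≤ ∑ a, ∑ i, ∑ k, u.2 a i k ^ 2 := by positivity
  have hA0 : 0 ≤ ∑ i, ∑ k, u.1 i k ^ 2 := by positivity
  refine lt_of_le_of_ne (by linarith) fun h => hu ?_
  have hP1 : ∑ a, ∑ i, ∑ k, u.2 a i k ^ 2 = 0 := by linarith
  have hA1 : ∑ i, ∑ k, u.1 i k ^ 2 = 0 := by linarith
  ext1
  · funext i k
    rw [Finset.sum_eq_zero_iff_of_nonneg fun _ _ => by positivity] at hA1
    have := hA1 i (Finset.mem_univ _)
    rw [Finset.sum_eq_zero_iff_of_nonneg fun _ _ => by positivity] at this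
    simpa using this k (Finset.mem_univ _)
  · funext a i k
    rw [Finset.sum_eq_zero_iff_of_nonneg fun _ _ => by positivity] at hP1
    have := hP1 a (Finset.mem_univ _)
    rw [Finset.sum_eq_zero_iff_of_nonneg fun _ _ => by positivity] at this
    have := this i (Finset.mem_univ _)
    rw [Finset.sum_eq_zero_iff_of_nonneg fun _ _ => by positivity] at this
    simpa using this k (Finset.mem_univ _)

/-- Positivity of the Bochner form is an open condition on the metric. -/
theorem eventually_bochnerForm_pos (hn : 3 ≤ n) :
    ∀ᶠ t in nhds (roundJet n), ∀ u : FormJet n, u ≠ 0 → 0 < bochnerForm t u := by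
  -- Tube lemma: positivity near each point `(roundJet n, u)` with `‖u‖ = 1` gives one neighbourhood
  -- of `roundJet n` valid for all unit `u`.
  have h := (isCompact_sphere (0 : FormJet n) 1).eventually_forall_of_forall_eventually
    (x₀ := roundJet n) (P := fun t u => 0 < bochnerForm t u) fun u hu => by
      have hu0 : u ≠ 0 := by
        rintro rfl
        simp at hu
      exact (continuous_bochnerForm.tendsto (roundJet n, u)).eventually
        (lt_mem_nhds (bochnerForm_roundJet_pos hn u hu0))
  filter_upwards [h] with t ht u hu
  have h1 := ht (‖u‖⁻¹ • u) (by simp [norm_smul, hu])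
  rw [bochnerForm_smul] at h1
  have : 0 < ‖u‖ := norm_pos_iff.2 hu
  exact pos_of_mul_pos_right h1 (by positivity)

end ChartCalculus

/-! ### Smoothness of the inverse matrix -/

section MatrixInverse

variable {E ι : Type*} [NormedAddCommGroup E] [NormedSpace ℝ E] [Fintype ι] [DecidableEq ι]
  {m : WithTop ℕ∞} {G : E → Matrix ι ι ℝ} {x : E}

theorem ContDiffAt.matrix_det_entries (hG : ∀ i j, ContDiffAt ℝ m (fun y => G y i j) x) :
    ContDiffAt ℝ m (fun y => (G y).det) x := by
  simp only [Matrix.det_apply]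
  exact ContDiffAt.sum fun σ _ => (contDiffAt_prod fun i _ => hG _ _).const_smul _

/-- Cramer's rule: each entry of the inverse is a minor determinant divided by `det G`. -/
theorem ContDiffAt.matrix_inv_entries (hG : ∀ i j, ContDiffAt ℝ m (fun y => G y i j) x)
    (hdet : (G x).det ≠ 0) (i j : ι) : ContDiffAt ℝ m (fun y => (G y)⁻¹ i j) x := by
  simp only [Matrix.inv_def, Ring.inverse_eq_inv', Matrix.smul_apply, smul_eq_mul,
    Matrix.adjugate_apply]
  refine ((ContDiffAt.matrix_det_entries hG).inv hdet).mul
    (ContDiffAt.matrix_det_entries fun k l => ?_)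
  by_cases hk : k = j
  · subst hk
    simpa using contDiffAt_const
  · simpa [Matrix.updateRow_ne hk] using hG k l

theorem Matrix.continuousAt_inv_of_det_ne_zero {A : Matrix ι ι ℝ} (hA : A.det ≠ 0) :
    ContinuousAt (fun B : Matrix ι ι ℝ => B⁻¹) A := by
  simp only [Matrix.inv_def, Ring.inverse_eq_inv']
  exact ((continuous_id.matrix_det.continuousAt).inv₀ hA).smul
    continuous_id.matrix_adjugate.continuousAt

end MatrixInverse

namespace ChartCalculus

variable {n : ℕ}

/-! ### Rules for partial derivatives -/

section Rules

variable {f g : EuclideanSpace ℝ (Fin n) → ℝ} {x : EuclideanSpace ℝ (Fin n)} (a : Fin n)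

theorem partialDeriv_fun_add (hf : DifferentiableAt ℝ f x) (hg : DifferentiableAt ℝ g x) :
    partialDeriv a (fun y => f y + g y) x = partialDeriv a f x + partialDeriv a g x := by
  simp [partialDeriv, fderiv_fun_add hf hg]

theorem partialDeriv_fun_sub (hf : DifferentiableAt ℝ f x) (hg : DifferentiableAt ℝ g x) :
    partialDeriv a (fun y => f y - g y) x = partialDeriv a f x - partialDeriv a g x := by
  simp [partialDeriv, fderiv_fun_sub hf hg]

theorem partialDeriv_fun_neg : partialDeriv a (fun y => -f y) x = -partialDeriv a f x := by
  simp [partialDeriv, fderiv_fun_neg]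

theorem partialDeriv_fun_mul (hf : DifferentiableAt ℝ f x) (hg : DifferentiableAt ℝ g x) :
    partialDeriv a (fun y => f y * g y) x
      = partialDeriv a f x * g x + f x * partialDeriv a g x := by
  simp [partialDeriv, fderiv_fun_mul hf hg]
  ring

theorem partialDeriv_const_mul (c : ℝ) (hf : DifferentiableAt ℝ f x) :
    partialDeriv a (fun y => c * f y) x = c * partialDeriv a f x := by
  simp [partialDeriv, fderiv_const_mul hf]

theorem partialDeriv_fun_sum {ι : Type*} {s : Finset ι} {F : ι → EuclideanSpace ℝ (Fin n) → ℝ}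
    (hF : ∀ i, DifferentiableAt ℝ (F i) x) :
    partialDeriv a (fun y => ∑ i ∈ s, F i y) x = ∑ i ∈ s, partialDeriv a (F i) x := by
  simp [partialDeriv, fderiv_fun_sum fun i _ => hF i]

theorem differentiableAt_partialDeriv (hf : ContDiffAt ℝ 2 f x) :
    DifferentiableAt ℝ (fun y => partialDeriv a f y) x := by
  have h := (hf.fderiv_right (m := 1) (by norm_num)).differentiableAt one_ne_zero
  exact h.clm_apply (differentiableAt_const _)

theorem partialDeriv_partialDeriv (hf : ContDiffAt ℝ 2 f x) (b : Fin n) :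
    partialDeriv a (fun y => partialDeriv b f y) x
      = fderiv ℝ (fderiv ℝ f) x (EuclideanSpace.single a 1) (EuclideanSpace.single b 1) := by
  have h := (hf.fderiv_right (m := 1) (by norm_num)).differentiableAt one_ne_zero
  simp only [partialDeriv]
  rw [fderiv_clm_apply h (differentiableAt_const _)]
  simp

theorem partialDeriv_comm (hf : ContDiffAt ℝ 2 f x) (b : Fin n) :
    partialDeriv a (fun y => partialDeriv b f y) x
      = partialDeriv b (fun y => partialDeriv a f y) x := by
  rw [partialDeriv_partialDeriv a hf, partialDeriv_partialDeriv b hf]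
  exact hf.isSymmSndFDerivAt (by simp) _ _

end Rules

/-! ### The Hodge-Laplacian in terms of jets -/

/-- The jet of a metric at a point. -/
def metricJet (G : EuclideanSpace ℝ (Fin n) → Matrix (Fin n) (Fin n) ℝ)
    (x : EuclideanSpace ℝ (Fin n)) : MetricJet n :=
  (fun i j => (G x)⁻¹ i j, fun a i j => partialDeriv a (fun y => G y i j) x,
    fun a b i j => partialDeriv a (fun y => partialDeriv b (fun z => G z i j) y) x)

/-- The 1-jet of a `TM`-valued 1-form at a point. -/
def formJet (θ : VForm n 1) (x : EuclideanSpace ℝ (Fin n)) : FormJet n :=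
  (fun i k => θ (fun _ => i) k x, fun a i k => partialDeriv a (θ (fun _ => i) k) x)

/-- The second derivatives of a `TM`-valued 1-form at a point. -/
def formDeriv₂ (θ : VForm n 1) (x : EuclideanSpace ℝ (Fin n)) (a b i k : Fin n) : ℝ :=
  partialDeriv a (fun y => partialDeriv b (θ (fun _ => i) k) y) x

variable {G : EuclideanSpace ℝ (Fin n) → Matrix (Fin n) (Fin n) ℝ} {θ : VForm n 1}
  {x : EuclideanSpace ℝ (Fin n)}

/-- Differentiating `G G⁻¹ = 1`, which holds near `x`, and multiplying by `G⁻¹` on the left gives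
`∂(G⁻¹) = -G⁻¹ (∂G) G⁻¹`. -/
theorem partialDeriv_inv (hG : ∀ i j, ContDiffAt ℝ 2 (fun y => G y i j) x)
    (hdet : (G x).det ≠ 0) (c a b : Fin n) :
    partialDeriv c (fun y => (G y)⁻¹ a b) x
      = invDeriv (metricJet G x).1 (metricJet G x).2.1 c a b := by
  have hd : ∀ i j, DifferentiableAt ℝ (fun y => G y i j) x := fun i j =>
    (hG i j).differentiableAt two_ne_zero
  have hi : ∀ i j, DifferentiableAt ℝ (fun y => (G y)⁻¹ i j) x := fun i j =>
    (ContDiffAt.matrix_inv_entries hG hdet i j).differentiableAt two_ne_zero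
  have key : ∀ k, ∑ l, (partialDeriv c (fun y => G y k l) x * (G x)⁻¹ l b
      + G x k l * partialDeriv c (fun y => (G y)⁻¹ l b) x) = 0 := fun k => by
    have h1 : (fun y => ∑ l, G y k l * (G y)⁻¹ l b)
        =ᶠ[nhds x] fun _ => (1 : Matrix (Fin n) (Fin n) ℝ) k b := by
      have : ∀ᶠ y in nhds x, (G y).det ≠ 0 :=
        (ContDiffAt.matrix_det_entries hG).continuousAt.eventually_ne hdet
      filter_upwards [this] with y hy
      rw [← Matrix.mul_apply, Matrix.mul_nonsing_inv _ hy.isUnit]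
    have h2 : partialDeriv c (fun y => ∑ l, G y k l * (G y)⁻¹ l b) x = 0 := by
      simp [partialDeriv, h1.fderiv_eq]
    rw [partialDeriv_fun_sum _ fun l => (hd k l).fun_mul (hi l b)] at h2
    simpa only [partialDeriv_fun_mul c (hd k _) (hi _ b)] using h2
  have hinv : ∀ l, ∑ k, (G x)⁻¹ a k * G x k l = (1 : Matrix (Fin n) (Fin n) ℝ) a l := fun l => by
    rw [← Matrix.mul_apply, Matrix.nonsing_inv_mul _ hdet.isUnit]
  have h3 : ∑ k, (G x)⁻¹ a k * ∑ l, (partialDeriv c (fun y => G y k l) x * (G x)⁻¹ l b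
      + G x k l * partialDeriv c (fun y => (G y)⁻¹ l b) x) = 0 := by simp [key]
  have h4 : ∑ k, (G x)⁻¹ a k * ∑ l, G x k l * partialDeriv c (fun y => (G y)⁻¹ l b) x
      = partialDeriv c (fun y => (G y)⁻¹ a b) x := by
    simp only [Finset.mul_sum, ← mul_assoc]
    rw [Finset.sum_comm]
    simp only [← Finset.sum_mul, hinv, Matrix.one_apply, ite_mul, one_mul, zero_mul,
      Finset.sum_ite_eq, Finset.mem_univ, if_true]
  simp only [Finset.sum_add_distrib, mul_add, h4] at h3
  simp only [invDeriv, metricJet]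
  rw [eq_neg_iff_add_eq_zero, add_comm, ← h3]
  simp only [Finset.mul_sum, mul_assoc]

theorem differentiableAt_christoffel (hG : ∀ i j, ContDiffAt ℝ 2 (fun y => G y i j) x)
    (hdet : (G x).det ≠ 0) (k i j : Fin n) :
    DifferentiableAt ℝ (fun y => christoffel G k i j y) x := by
  have hi : ∀ i j, DifferentiableAt ℝ (fun y => (G y)⁻¹ i j) x := fun i j =>
    (ContDiffAt.matrix_inv_entries hG hdet i j).differentiableAt two_ne_zero
  have hp := fun a i j => differentiableAt_partialDeriv a (hG i j)
  unfold christoffel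
  exact (DifferentiableAt.fun_sum fun l _ =>
    (hi k l).fun_mul (((hp i j l).fun_add (hp j i l)).fun_sub (hp l i j))).const_mul _

theorem partialDeriv_christoffel (hG : ∀ i j, ContDiffAt ℝ 2 (fun y => G y i j) x)
    (hdet : (G x).det ≠ 0) (a k i j : Fin n) :
    partialDeriv a (fun y => christoffel G k i j y) x
      = christoffelDerivJet (metricJet G x).1 (metricJet G x).2.1 (metricJet G x).2.2 a k i j := by
  have hi : ∀ i j, DifferentiableAt ℝ (fun y => (G y)⁻¹ i j) x := fun i j =>
    (ContDiffAt.matrix_inv_entries hG hdet i j).differentiableAt two_ne_zero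
  have hp := fun a i j => differentiableAt_partialDeriv a (hG i j)
  unfold christoffel
  rw [partialDeriv_const_mul _ _ (DifferentiableAt.fun_sum fun l _ =>
      (hi k l).fun_mul (((hp i j l).fun_add (hp j i l)).fun_sub (hp l i j))),
    partialDeriv_fun_sum _ fun l => (hi k l).fun_mul (((hp i j l).fun_add (hp j i l)).fun_sub (hp l i j)),
    christoffelDerivJet]
  congr 1
  refine Finset.sum_congr rfl fun l _ => ?_
  rw [partialDeriv_fun_mul _ (hi k l) (((hp i j l).fun_add (hp j i l)).fun_sub (hp l i j)),
    partialDeriv_fun_sub _ ((hp i j l).fun_add (hp j i l)) (hp l i j),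
    partialDeriv_fun_add _ (hp i j l) (hp j i l), partialDeriv_inv hG hdet]
  rfl

theorem covDeriv_one (G : EuclideanSpace ℝ (Fin n) → Matrix (Fin n) (Fin n) ℝ) (θ : VForm n 1)
    (x : EuclideanSpace ℝ (Fin n)) (a : Fin n) (i : Fin 1 → Fin n) (k : Fin n) :
    covDeriv G θ a i k x = covJet (fun k i j => christoffel G k i j x) (formJet θ x).1
      (formJet θ x).2 a (i 0) k := by
  obtain ⟨i, rfl⟩ : ∃ j : Fin n, i = fun _ => j :=
    ⟨i 0, funext fun s => by rw [Subsingleton.elim s 0]⟩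
  have h : ∀ l : Fin n, Function.update (fun _ : Fin 1 => i) 0 l = fun _ => l := fun l =>
    funext fun s => by rw [Subsingleton.elim s 0, Function.update_self]
  simp only [covDeriv, covJet, formJet, Fin.sum_univ_one, h]

theorem differentiableAt_covDeriv_one (hG : ∀ i j, ContDiffAt ℝ 2 (fun y => G y i j) x)
    (hdet : (G x).det ≠ 0) (hθ : ∀ i k, ContDiffAt ℝ 2 (θ i k) x) (a : Fin n)
    (i : Fin 1 → Fin n) (k : Fin n) :
    DifferentiableAt ℝ (covDeriv G θ a i k) x := by
  have hΓ := differentiableAt_christoffel hG hdet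
  have hd := fun i k => (hθ i k).differentiableAt two_ne_zero
  exact ((differentiableAt_partialDeriv a (hθ i k)).add
    (DifferentiableAt.fun_sum fun l _ => (hΓ k a l).fun_mul (hd i l))).fun_sub
      (DifferentiableAt.fun_sum fun s _ => DifferentiableAt.fun_sum fun l _ =>
        (hΓ l a (i s)).fun_mul (hd _ k))

theorem partialDeriv_covDeriv_one (hG : ∀ i j, ContDiffAt ℝ 2 (fun y => G y i j) x)
    (hdet : (G x).det ≠ 0) (hθ : ∀ i k, ContDiffAt ℝ 2 (θ i k) x) (c a : Fin n)
    (i : Fin 1 → Fin n) (k : Fin n) :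
    partialDeriv c (covDeriv G θ a i k) x
      = covDerivJet (christoffelJet (metricJet G x).1 (metricJet G x).2.1)
        (christoffelDerivJet (metricJet G x).1 (metricJet G x).2.1 (metricJet G x).2.2)
        (formJet θ x).1 (formJet θ x).2 (formDeriv₂ θ x) c a (i 0) k := by
  have hΓ := differentiableAt_christoffel hG hdet
  have hd := fun i k => (hθ i k).differentiableAt two_ne_zero
  have hp := differentiableAt_partialDeriv a (hθ (fun _ => i 0) k)
  have e : covDeriv G θ a i k = fun y => partialDeriv a (θ (fun _ => i 0) k) y
      + ∑ l, christoffel G k a l y * θ (fun _ => i 0) l y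
      - ∑ l, christoffel G l a (i 0) y * θ (fun _ => l) k y := funext fun y => covDeriv_one ..
  rw [e, partialDeriv_fun_sub _ (hp.fun_add (DifferentiableAt.fun_sum fun l _ =>
      (hΓ k a l).fun_mul (hd _ l))) (DifferentiableAt.fun_sum fun l _ => (hΓ l a (i 0)).fun_mul (hd _ k)),
    partialDeriv_fun_add _ hp (DifferentiableAt.fun_sum fun l _ => (hΓ k a l).fun_mul (hd _ l)),
    partialDeriv_fun_sum _ fun l => (hΓ k a l).fun_mul (hd _ l),
    partialDeriv_fun_sum _ fun l => (hΓ l a (i 0)).fun_mul (hd _ k)]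
  simp only [partialDeriv_fun_mul c (hΓ _ _ _) (hd _ _), partialDeriv_christoffel hG hdet]
  rfl

theorem codiff_one (G : EuclideanSpace ℝ (Fin n) → Matrix (Fin n) (Fin n) ℝ) (θ : VForm n 1)
    (i : Fin 0 → Fin n) (k : Fin n) :
    codiff G θ i k = fun y => -∑ a, ∑ b, (G y)⁻¹ a b * covDeriv G θ a (fun _ => b) k y := by
  funext y
  have h : ∀ b : Fin n, (Fin.cons b i : Fin 1 → Fin n) = fun _ => b := fun b =>
    funext fun s => by rw [show s = 0 from Fin.fin_one_eq_zero s, Fin.cons_zero]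
  simp only [codiff, h]

theorem extD_one (G : EuclideanSpace ℝ (Fin n) → Matrix (Fin n) (Fin n) ℝ) (θ : VForm n 1)
    (i : Fin 2 → Fin n) (k : Fin n) :
    extD G θ i k = fun y => covDeriv G θ (i 0) (fun _ => i 1) k y
      - covDeriv G θ (i 1) (fun _ => i 0) k y := by
  funext y
  have h0 : (fun r : Fin 1 => i ((0 : Fin 2).succAbove r)) = fun _ => i 1 :=
    funext fun r => by rw [Subsingleton.elim r 0]; rfl
  have h1 : (fun r : Fin 1 => i ((1 : Fin 2).succAbove r)) = fun _ => i 0 :=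
    funext fun r => by rw [Subsingleton.elim r 0]; rfl
  refine (Fin.sum_univ_two _).trans ?_
  rw [h0, h1]
  simp [sub_eq_add_neg]

/-- As `δθ` has degree zero, `d(δθ)` is its covariant derivative as a vector field: the only
Christoffel correction is on the vector index. -/
theorem extD_codiff_one (hG : ∀ i j, ContDiffAt ℝ 2 (fun y => G y i j) x)
    (hdet : (G x).det ≠ 0) (hθ : ∀ i k, ContDiffAt ℝ 2 (θ i k) x) (i : Fin 1 → Fin n)
    (k : Fin n) :
    extD G (codiff G θ) i k x
      = -∑ a, ∑ b, (partialDeriv (i 0) (fun y => (G y)⁻¹ a b) x * covDeriv G θ a (fun _ => b) k x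
          + (G x)⁻¹ a b * partialDeriv (i 0) (covDeriv G θ a (fun _ => b) k) x)
        + ∑ l, christoffel G k (i 0) l x
          * (-∑ a, ∑ b, (G x)⁻¹ a b * covDeriv G θ a (fun _ => b) l x) := by
  have hi : ∀ i j, DifferentiableAt ℝ (fun y => (G y)⁻¹ i j) x := fun i j =>
    (ContDiffAt.matrix_inv_entries hG hdet i j).differentiableAt two_ne_zero
  have hc := differentiableAt_covDeriv_one hG hdet hθ
  have hs : ∀ a, DifferentiableAt ℝ
      (fun y => ∑ b, (G y)⁻¹ a b * covDeriv G θ a (fun _ => b) k y) x := fun a =>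
    DifferentiableAt.fun_sum fun b _ => (hi a b).fun_mul (hc a _ k)
  refine (Fin.sum_univ_one _).trans ?_
  rw [Fin.val_zero, pow_zero, one_mul, covDeriv, Fin.sum_univ_zero, sub_zero, codiff_one,
    partialDeriv_fun_neg, partialDeriv_fun_sum _ hs]
  simp only [partialDeriv_fun_sum _ fun b => (hi _ b).fun_mul (hc _ (fun _ => b) k),
    partialDeriv_fun_mul (i 0) (hi _ _) (hc _ _ k), codiff_one]

theorem covDeriv_two (G : EuclideanSpace ℝ (Fin n) → Matrix (Fin n) (Fin n) ℝ) (η : VForm n 2)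
    (x : EuclideanSpace ℝ (Fin n)) (a b j k : Fin n) :
    covDeriv G η a ![b, j] k x = partialDeriv a (η ![b, j] k) x
      + ∑ l, christoffel G k a l x * η ![b, j] l x
      - (∑ l, christoffel G l a b x * η ![l, j] k x
        + ∑ l, christoffel G l a j x * η ![b, l] k x) := by
  have h0 : ∀ l : Fin n, Function.update (![b, j] : Fin 2 → Fin n) 0 l = ![l, j] :=
    fun l => by funext s; fin_cases s <;> rfl
  have h1 : ∀ l : Fin n, Function.update (![b, j] : Fin 2 → Fin n) 1 l = ![b, l] :=
    fun l => by funext s; fin_cases s <;> rfl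
  simp only [covDeriv, Fin.sum_univ_two, h0, h1, Matrix.cons_val_zero, Matrix.cons_val_one]

theorem codiff_two (G : EuclideanSpace ℝ (Fin n) → Matrix (Fin n) (Fin n) ℝ) (η : VForm n 2)
    (i : Fin 1 → Fin n) (k : Fin n) (x : EuclideanSpace ℝ (Fin n)) :
    codiff G η i k x = -∑ a, ∑ b, (G x)⁻¹ a b * covDeriv G η a ![b, i 0] k x := by
  have h : ∀ b : Fin n, (Fin.cons b i : Fin 2 → Fin n) = ![b, i 0] := fun b => by
    funext s; fin_cases s <;> rfl
  simp only [codiff, h]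

theorem partialDeriv_extD_one (hG : ∀ i j, ContDiffAt ℝ 2 (fun y => G y i j) x)
    (hdet : (G x).det ≠ 0) (hθ : ∀ i k, ContDiffAt ℝ 2 (θ i k) x) (a b j k : Fin n) :
    partialDeriv a (extD G θ ![b, j] k) x
      = partialDeriv a (covDeriv G θ b (fun _ => j) k) x
        - partialDeriv a (covDeriv G θ j (fun _ => b) k) x := by
  have hc := differentiableAt_covDeriv_one hG hdet hθ
  rw [extD_one, partialDeriv_fun_sub _ (hc _ _ _) (hc _ _ _)]
  rfl

/-- The Hodge-Laplacian on `TM`-valued 1-forms: `-∑ gᵃᵇ ∂ₐ∂_b` plus terms of lower order. -/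
theorem hodgeLaplace_one (hG : ∀ i j, ContDiffAt ℝ 2 (fun y => G y i j) x)
    (hdet : (G x).det ≠ 0) (hθ : ∀ i k, ContDiffAt ℝ 2 (θ i k) x) (i : Fin 1 → Fin n)
    (k : Fin n) :
    hodgeLaplace G θ i k x = -∑ a, ∑ b, (G x)⁻¹ a b * formDeriv₂ θ x a b (i 0) k
      + lowerLaplace (metricJet G x) (formJet θ x) (i 0) k := by
  refine Eq.trans ?_ (laplaceJet_eq_add (metricJet G x).1 _ _ _ _ _ (formDeriv₂ θ x)
    (fun a b i k => partialDeriv_comm a (hθ _ k) b) (i 0) k)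
  rw [hodgeLaplace, extD_codiff_one hG hdet hθ, codiff_two]
  simp only [covDeriv_two, partialDeriv_extD_one hG hdet hθ]
  simp only [extD_one, partialDeriv_covDeriv_one hG hdet hθ]
  simp only [covDeriv_one, partialDeriv_inv hG hdet,
    Matrix.cons_val_zero, Matrix.cons_val_one]
  rfl

end ChartCalculus

/-! ### Second derivative test and trace of a complex structure -/

/-- The second derivative test: the Hessian at a local maximum is negative semidefinite. -/
theorem IsLocalMax.fderiv_fderiv_apply_self_nonpos {E : Type*} [NormedAddCommGroup E]
    [NormedSpace ℝ E] {f : E → ℝ} {x : E} (h : IsLocalMax f x) (hf : ContDiffAt ℝ 2 f x) (v : E) :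
    fderiv ℝ (fderiv ℝ f) x v v ≤ 0 := by
  by_contra! hpos
  have hc : ∀ t : ℝ, HasDerivAt (fun t : ℝ => x + t • v) v t := fun t => by
    simpa using ((hasDerivAt_id t).smul_const v).const_add x
  have hc0 : Filter.Tendsto (fun t : ℝ => x + t • v) (nhds 0) (nhds x) := by
    simpa using (hc 0).continuousAt.tendsto
  set g : ℝ → ℝ := fun t => f (x + t • v) with hg
  have hd : deriv g =ᶠ[nhds 0] fun t => fderiv ℝ f (x + t • v) v := by
    filter_upwards [hc0.eventually (hf.eventually (by simp))] with t ht
    exact ((ht.differentiableAt two_ne_zero).hasFDerivAt.comp_hasDerivAt t (hc t)).deriv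
  have hdd : deriv (deriv g) 0 = fderiv ℝ (fderiv ℝ f) x v v := by
    rw [hd.deriv_eq]
    have h1 : HasFDerivAt (fderiv ℝ f) (fderiv ℝ (fderiv ℝ f) x) (x + (0 : ℝ) • v) := by
      simpa using ((hf.fderiv_right (m := 1) (by norm_num)).differentiableAt
        one_ne_zero).hasFDerivAt
    have h2 : HasDerivAt (fun t : ℝ => fderiv ℝ f (x + t • v)) (fderiv ℝ (fderiv ℝ f) x v) 0 :=
      h1.comp_hasDerivAt (0 : ℝ) (hc 0)
    exact (((ContinuousLinearMap.apply ℝ ℝ v).hasFDerivAt).comp_hasDerivAt (0 : ℝ) h2).deriv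
  have hmax : IsLocalMax g 0 := by
    have := hc0.eventually h
    simpa [IsLocalMax, IsMaxFilter, hg] using this
  have hcont : ContinuousAt g 0 := by
    have : ContinuousAt f (x + (0 : ℝ) • v) := by simpa using hf.continuousAt
    exact ContinuousAt.comp (f := fun t : ℝ => x + t • v) this (hc 0).continuousAt
  -- A positive second derivative would make `0` a local minimum as well, hence `g` locally
  -- constant, with second derivative zero.
  have hmin : IsLocalMin g 0 :=
    isLocalMin_of_deriv_deriv_pos (by rw [hdd]; exact hpos) hmax.deriv_eq_zero hcont
  have hconst : g =ᶠ[nhds 0] fun _ => g 0 := by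
    filter_upwards [hmax, hmin] with t h1 h2 using le_antisymm h1 h2
  have : deriv (deriv g) 0 = 0 := by simp [hconst.deriv.deriv_eq]
  exact hpos.ne' (hdd ▸ this)

/-- A complex structure on `ℝⁿ` has trace zero. -/
theorem Matrix.trace_eq_zero_of_mul_self_eq_neg_one {ι : Type*} [Fintype ι] [DecidableEq ι]
    {A : Matrix ι ι ℝ} (hA : A * A = -1) : A.trace = 0 := by
  set B : Matrix ι ι ℂ := A.map (algebraMap ℝ ℂ) with hB
  have hBB : B * B = -1 := by
    rw [hB, ← Matrix.map_mul, hA]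
    ext i j
    by_cases h : i = j <;> simp [h]
  -- `P` is the projection onto the `i`-eigenspace of the complexification of `A`.
  set P : Matrix ι ι ℂ := (1 / 2 : ℂ) • (1 - Complex.I • B) with hP
  have hPP : P * P = P := by
    have : (1 - Complex.I • B) * (1 - Complex.I • B) = (2 : ℂ) • (1 - Complex.I • B) := by
      simp only [mul_sub, sub_mul, one_mul, mul_one, Matrix.smul_mul, Matrix.mul_smul, hBB,
        smul_smul, Complex.I_mul_I, smul_neg, neg_smul, one_smul, two_smul]
      abel
    rw [hP, Matrix.smul_mul, Matrix.mul_smul, this, smul_smul, smul_smul]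
    norm_num
  have hid : IsIdempotentElem (Matrix.toLin' P) := by
    rw [IsIdempotentElem, Module.End.mul_eq_comp, ← Matrix.toLin'_mul, hPP]
  -- The trace of a projection is its rank, a real number, while the imaginary part of `tr P` is `-½
  -- tr A`.
  have htr := (LinearMap.IsIdempotentElem.isProj_range _ hid).trace
  rw [Matrix.trace_toLin'_eq, hP, Matrix.trace_smul, Matrix.trace_sub, Matrix.trace_smul,
    Matrix.trace_one] at htr
  have hBt : B.trace = (A.trace : ℂ) := by
    simp [hB, Matrix.trace]
  rw [hBt] at htr
  have := congrArg Complex.im htr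
  simpa using this

/-! ### The Bochner argument at a maximum -/

namespace ChartCalculus

variable {n : ℕ}

-- Writing `H = Bᵀ B` turns the contraction into a sum of values of the Hessian on the rows of `B`,
-- each nonpositive at a maximum.
open scoped MatrixOrder in
theorem sum_mul_hessian_nonpos {f : EuclideanSpace ℝ (Fin n) → ℝ} {x : EuclideanSpace ℝ (Fin n)}
    (h : IsLocalMax f x) (hf : ContDiffAt ℝ 2 f x) {H : Matrix (Fin n) (Fin n) ℝ}
    (hH : H.PosSemidef) :
    ∑ a, ∑ b, H a b * partialDeriv a (fun y => partialDeriv b f y) x ≤ 0 := by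
  obtain ⟨B, rfl⟩ := CStarAlgebra.nonneg_iff_eq_star_mul_self.mp hH.nonneg
  simp only [partialDeriv_partialDeriv _ hf]
  have key : ∀ c, ∑ a, ∑ b, B c a * B c b
      * fderiv ℝ (fderiv ℝ f) x (EuclideanSpace.single a 1) (EuclideanSpace.single b 1)
      = fderiv ℝ (fderiv ℝ f) x (∑ a, B c a • EuclideanSpace.single a 1)
        (∑ a, B c a • EuclideanSpace.single a 1) := fun c => by
    simp only [map_sum, map_smul, sum_apply, smul_apply,
      smul_eq_mul, Finset.mul_sum, mul_assoc]
    rw [Finset.sum_comm]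
    refine Finset.sum_congr rfl fun a _ => Finset.sum_congr rfl fun b _ => by ring
  calc _ = ∑ c, ∑ a, ∑ b, B c a * B c b
      * fderiv ℝ (fderiv ℝ f) x (EuclideanSpace.single a 1) (EuclideanSpace.single b 1) := by
        simp only [Matrix.mul_apply, Matrix.star_apply, star_trivial, Finset.sum_mul]
        rw [Finset.sum_comm]
        conv_rhs => rw [Finset.sum_comm]
        rw [Finset.sum_comm]
        refine Finset.sum_congr rfl fun a _ => ?_
        rw [Finset.sum_comm]
    _ ≤ 0 := Finset.sum_nonpos fun c _ => by
        rw [key]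
        exact h.fderiv_fderiv_apply_self_nonpos hf _

/-- The squared norm of a `TM`-valued 1-form in a conformal chart. -/
def normSq (θ : VForm n 1) (x : EuclideanSpace ℝ (Fin n)) : ℝ :=
  ∑ i, ∑ k, θ (fun _ => i) k x ^ 2

variable {G : EuclideanSpace ℝ (Fin n) → Matrix (Fin n) (Fin n) ℝ} {θ : VForm n 1}
  {x : EuclideanSpace ℝ (Fin n)}

theorem contDiffAt_normSq (hθ : ∀ i k, ContDiffAt ℝ 2 (θ i k) x) :
    ContDiffAt ℝ 2 (normSq θ) x :=
  ContDiffAt.sum fun _ _ => ContDiffAt.sum fun _ _ => (hθ _ _).pow 2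

theorem partialDeriv_partialDeriv_sq {f : EuclideanSpace ℝ (Fin n) → ℝ}
    (hf : ContDiffAt ℝ 2 f x) (a b : Fin n) :
    partialDeriv a (fun y => partialDeriv b (fun z => f z ^ 2) y) x
      = 2 * (partialDeriv a f x * partialDeriv b f x
        + f x * partialDeriv a (fun y => partialDeriv b f y) x) := by
  have h1 : (fun y => partialDeriv b (fun z => f z ^ 2) y)
      =ᶠ[nhds x] fun y => 2 * (f y * partialDeriv b f y) := by
    filter_upwards [hf.eventually (by simp)] with y hy
    have hy' := hy.differentiableAt two_ne_zero
    simp only [sq, partialDeriv_fun_mul b hy' hy']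
    ring
  rw [partialDeriv, h1.fderiv_eq, ← partialDeriv,
    partialDeriv_const_mul _ _ ((hf.differentiableAt two_ne_zero).fun_mul
      (differentiableAt_partialDeriv b hf)),
    partialDeriv_fun_mul _ (hf.differentiableAt two_ne_zero) (differentiableAt_partialDeriv b hf)]

theorem partialDeriv_partialDeriv_normSq (hθ : ∀ i k, ContDiffAt ℝ 2 (θ i k) x) (a b : Fin n) :
    partialDeriv a (fun y => partialDeriv b (normSq θ) y) x
      = ∑ i, ∑ k, 2 * ((formJet θ x).2 a i k * (formJet θ x).2 b i k
        + (formJet θ x).1 i k * formDeriv₂ θ x a b i k) := by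
  have hsq := fun i k => (hθ (fun _ => i) k).pow 2
  have hs : ∀ i, ContDiffAt ℝ 2 (fun y => ∑ k, θ (fun _ => i) k y ^ 2) x := fun i =>
    ContDiffAt.sum fun k _ => hsq i k
  have e : ∀ {ι : Type} [Fintype ι] (F : ι → EuclideanSpace ℝ (Fin n) → ℝ),
      (∀ i, ContDiffAt ℝ 2 (F i) x) →
      partialDeriv a (fun y => partialDeriv b (fun z => ∑ i, F i z) y) x
        = ∑ i, partialDeriv a (fun y => partialDeriv b (F i) y) x := fun {ι} _ F hF => by
    have h1 : (fun y => partialDeriv b (fun z => ∑ i, F i z) y)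
        =ᶠ[nhds x] fun y => ∑ i, partialDeriv b (F i) y := by
      have : ∀ᶠ y in nhds x, ∀ i, ContDiffAt ℝ 2 (F i) y :=
        Filter.eventually_all.2 fun i => (hF i).eventually (by simp)
      filter_upwards [this] with y hy
      exact partialDeriv_fun_sum _ fun i => (hy i).differentiableAt two_ne_zero
    rw [partialDeriv, h1.fderiv_eq, ← partialDeriv,
      partialDeriv_fun_sum _ fun i => differentiableAt_partialDeriv b (hF i)]
  unfold normSq
  rw [e _ hs]
  refine Finset.sum_congr rfl fun i _ => ?_
  rw [e _ (hsq i)]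
  exact Finset.sum_congr rfl fun k _ => partialDeriv_partialDeriv_sq (hθ _ k) a b

theorem sum_sum_comm {ι : Type*} [Fintype ι] (F : ι → ι → ι → ι → ℝ) :
    ∑ i, ∑ k, ∑ a, ∑ b, F i k a b = ∑ a, ∑ b, ∑ i, ∑ k, F i k a b := by
  have h : ∑ p : ι × ι, ∑ q : ι × ι, F p.1 p.2 q.1 q.2
      = ∑ q : ι × ι, ∑ p : ι × ι, F p.1 p.2 q.1 q.2 := Finset.sum_comm
  simpa only [Fintype.sum_prod_type] using h

/-- The Bochner argument: at a local maximum of its squared norm, a trace-free harmonic 1-form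
vanishes, if the Bochner form of the metric is positive. -/
theorem exists_hodgeLaplace_ne_zero (hG : ∀ i j, ContDiffAt ℝ 2 (fun y => G y i j) x)
    (hpos : (G x).PosDef) (hθ : ∀ i k, ContDiffAt ℝ 2 (θ i k) x)
    (hmax : IsLocalMax (normSq θ) x) (htr : ∑ i, θ (fun _ => i) i x = 0)
    (hne : formJet θ x ≠ 0)
    (hQ : ∀ u : FormJet n, u ≠ 0 → 0 < bochnerForm (metricJet G x) u) :
    ∃ (i : Fin 1 → Fin n) (k : Fin n), hodgeLaplace G θ i k x ≠ 0 := by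
  by_contra! h
  -- Harmonicity trades the second derivatives of `θ` for the lower-order part.
  have h1 : ∀ i k, lowerLaplace (metricJet G x) (formJet θ x) i k
      = ∑ a, ∑ b, (G x)⁻¹ a b * formDeriv₂ θ x a b i k := fun i k => by
    have := h (fun _ => i) k
    rw [hodgeLaplace_one hG hpos.det_pos.ne' hθ] at this
    linarith
  have h2 := sum_mul_hessian_nonpos hmax (contDiffAt_normSq hθ) hpos.inv.posSemidef
  have h3 := hQ _ hne
  have h4 : ∑ i, (formJet θ x).1 i i = 0 := htr
  -- The left side is nonpositive by `h2` and the right side positive by `h3`. The identity uses `tr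
  -- θ = 0` to discard the square of the trace.
  have h5 : ∑ a, ∑ b, (G x)⁻¹ a b * partialDeriv a (fun y => partialDeriv b (normSq θ) y) x
      = 2 * bochnerForm (metricJet G x) (formJet θ x) := by
    simp only [bochnerForm, h4, h1, partialDeriv_partialDeriv_normSq hθ]
    have e1 : ∑ i, ∑ k, (formJet θ x).1 i k * ∑ a, ∑ b, (G x)⁻¹ a b * formDeriv₂ θ x a b i k
        = ∑ a, ∑ b, (G x)⁻¹ a b * ∑ i, ∑ k, (formJet θ x).1 i k * formDeriv₂ θ x a b i k := by
      simp only [Finset.mul_sum, mul_left_comm ((G x)⁻¹ _ _)]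
      exact sum_sum_comm _
    rw [e1]
    simp only [← Finset.mul_sum, Finset.sum_add_distrib, mul_add, mul_left_comm _ (2 : ℝ)]
    simp [metricJet]
  linarith

end ChartCalculus

/-! ### Stability of positivity under `C²`-small changes of the metric -/

namespace ChartCalculus

variable {n : ℕ}

/-- A metric whose 2-jet is close to that of the round metric has positive Bochner form. -/
theorem exists_bochnerForm_pos_of_close (hn : 3 ≤ n) :
    ∃ ε : ℝ, 0 < ε ∧ ∀ (G : EuclideanSpace ℝ (Fin n) → Matrix (Fin n) (Fin n) ℝ)
      (x : EuclideanSpace ℝ (Fin n)),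
      (∀ i j, |G x i j - (roundJet n).1 i j| < ε) →
      (∀ a i j, |partialDeriv a (fun y => G y i j) x - (roundJet n).2.1 a i j| < ε) →
      (∀ a b i j, |partialDeriv a (fun y => partialDeriv b (fun z => G z i j) y) x
        - (roundJet n).2.2 a b i j| < ε) →
      ∀ u : FormJet n, u ≠ 0 → 0 < bochnerForm (metricJet G x) u := by
  have h1 : (Matrix.of (roundJet n).1) = (1 : Matrix (Fin n) (Fin n) ℝ) := by
    ext i j
    simp [roundJet, Matrix.one_apply]
  have hinv : ContinuousAt (fun A : Fin n → Fin n → ℝ => (Matrix.of A)⁻¹) (roundJet n).1 :=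
    Matrix.continuousAt_inv_of_det_ne_zero (A := Matrix.of (roundJet n).1) (by simp [h1])
  -- A `MetricJet` stores the inverse metric, whereas closeness is assumed for the metric. Inverting
  -- the first component is continuous and fixes `roundJet n`, whose metric is the identity.
  have hcont : Filter.Tendsto
      (fun j : MetricJet n => ((fun a b => (Matrix.of j.1)⁻¹ a b, j.2) : MetricJet n))
      (nhds (roundJet n)) (nhds (roundJet n)) := by
    have h2 : ContinuousAt
        (fun j : MetricJet n => ((fun a b => (Matrix.of j.1)⁻¹ a b, j.2) : MetricJet n))
        (roundJet n) := by
      refine ContinuousAt.prodMk ?_ continuousAt_snd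
      exact ContinuousAt.comp (f := Prod.fst) hinv continuousAt_fst
    have h3 : ((fun a b => (Matrix.of (roundJet n).1)⁻¹ a b, (roundJet n).2) : MetricJet n)
        = roundJet n := by
      refine Prod.ext ?_ rfl
      rw [h1, inv_one, ← h1]
      rfl
    have := h2.tendsto
    rwa [h3] at this
  obtain ⟨ε, hε, h⟩ := Metric.eventually_nhds_iff.1
    (hcont.eventually (eventually_bochnerForm_pos hn))
  refine ⟨ε, hε, fun G x hG0 hG1 hG2 => ?_⟩
  refine h (y := (fun i j => G x i j, (metricJet G x).2)) ?_
  simp only [Prod.dist_eq, max_lt_iff, dist_pi_lt_iff hε, Real.dist_eq]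
  exact ⟨hG0, hG1, hG2⟩

/-! ### The 2-jet of the conformal factor of stereographic projection -/

/-- The conformal factor of the round metric in a stereographic chart. -/
def stereoFactor (x : EuclideanSpace ℝ (Fin n)) : ℝ := 16 / (‖x‖ ^ 2 + 4) ^ 2

theorem contDiff_stereoFactor {m : WithTop ℕ∞} :
    ContDiff ℝ m (stereoFactor : EuclideanSpace ℝ (Fin n) → ℝ) := by
  refine contDiff_const.div (((contDiff_norm_sq ℝ).add contDiff_const).pow 2) fun x => ?_
  positivity

theorem partialDeriv_norm_sq (a : Fin n) (x : EuclideanSpace ℝ (Fin n)) :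
    partialDeriv a (fun y => ‖y‖ ^ 2) x = 2 * x a := by
  rw [partialDeriv, fderiv_norm_sq_apply]
  simp [EuclideanSpace.inner_single_right]

theorem partialDeriv_coord (a b : Fin n) (x : EuclideanSpace ℝ (Fin n)) :
    partialDeriv a (fun y => y b) x = if a = b then 1 else 0 := by
  have : HasFDerivAt (fun y : EuclideanSpace ℝ (Fin n) => y b)
      (EuclideanSpace.proj b : EuclideanSpace ℝ (Fin n) →L[ℝ] ℝ) x :=
    (EuclideanSpace.proj b : EuclideanSpace ℝ (Fin n) →L[ℝ] ℝ).hasFDerivAt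
  rw [partialDeriv, this.fderiv]
  simp [eq_comm]

theorem partialDeriv_stereoFactor (a : Fin n) (x : EuclideanSpace ℝ (Fin n)) :
    partialDeriv a stereoFactor x = x a * (-64 / (‖x‖ ^ 2 + 4) ^ 3) := by
  have hs : HasFDerivAt (fun y : EuclideanSpace ℝ (Fin n) => ‖y‖ ^ 2)
      (fderiv ℝ (fun y : EuclideanSpace ℝ (Fin n) => ‖y‖ ^ 2) x) x :=
    ((contDiff_norm_sq ℝ (n := 1)).differentiable one_ne_zero x).hasFDerivAt
  have h1 : HasDerivAt (fun r : ℝ => 16 / (r + 4) ^ 2) (-32 / (‖x‖ ^ 2 + 4) ^ 3) (‖x‖ ^ 2) := by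
    have hne : ‖x‖ ^ 2 + 4 ≠ 0 := by positivity
    have := ((((hasDerivAt_id (‖x‖ ^ 2)).add_const 4).pow 2).inv (pow_ne_zero 2 hne)).const_mul 16
    refine (this.congr_deriv ?_).congr_of_eventuallyEq ?_
    · simp
      field_simp
      norm_num
    · exact Filter.Eventually.of_forall fun r => by simp [div_eq_mul_inv]
  have h2 := (h1.comp_hasFDerivAt x hs).fderiv
  have h3 : fderiv ℝ stereoFactor x = _ := h2
  rw [partialDeriv, h3]
  have := partialDeriv_norm_sq a x
  rw [partialDeriv] at this
  simp only [smul_apply, this, smul_eq_mul]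
  ring

theorem partialDeriv_stereoFactor_zero (a : Fin n) :
    partialDeriv a stereoFactor (0 : EuclideanSpace ℝ (Fin n)) = 0 := by
  simp [partialDeriv_stereoFactor]

/-- The gradient is `xₐ` times a smooth factor equal to `-64 / 4³ = -1` at the origin; this is the
`-1` in `roundJet`. -/
theorem partialDeriv_partialDeriv_stereoFactor_zero (a b : Fin n) :
    partialDeriv a (fun y => partialDeriv b stereoFactor y) (0 : EuclideanSpace ℝ (Fin n))
      = if a = b then -1 else 0 := by
  simp only [partialDeriv_stereoFactor]
  rw [partialDeriv_fun_mul, partialDeriv_coord]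
  · simp
    split_ifs <;> norm_num
  · fun_prop
  · have : ContDiff ℝ 1 fun y : EuclideanSpace ℝ (Fin n) => -64 / (‖y‖ ^ 2 + 4) ^ 3 :=
      contDiff_const.div (((contDiff_norm_sq ℝ).add contDiff_const).pow 3) fun x => by positivity
    exact this.differentiable one_ne_zero 0

/-- The round metric in a stereographic chart. -/
def stereoMetric (x : EuclideanSpace ℝ (Fin n)) : Matrix (Fin n) (Fin n) ℝ :=
  stereoFactor x • (1 : Matrix (Fin n) (Fin n) ℝ)

theorem stereoMetric_apply (i j : Fin n) :
    (fun x : EuclideanSpace ℝ (Fin n) => stereoMetric x i j)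
      = fun x => (if i = j then 1 else 0) * stereoFactor x := by
  funext x
  simp [stereoMetric, Matrix.one_apply, mul_comm]

theorem contDiff_stereoMetric {m : WithTop ℕ∞} (i j : Fin n) :
    ContDiff ℝ m fun x : EuclideanSpace ℝ (Fin n) => stereoMetric x i j := by
  rw [stereoMetric_apply]
  exact contDiff_const.mul contDiff_stereoFactor

theorem stereoMetric_zero_apply (i j : Fin n) : stereoMetric 0 i j = (roundJet n).1 i j := by
  refine (congrFun (stereoMetric_apply i j) 0).trans ?_
  simp [stereoFactor, roundJet]
  norm_num

theorem partialDeriv_stereoMetric_zero (a i j : Fin n) :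
    partialDeriv a (fun x => stereoMetric x i j) 0 = (roundJet n).2.1 a i j := by
  rw [stereoMetric_apply,
    partialDeriv_const_mul _ _ (contDiff_stereoFactor.differentiable one_ne_zero 0),
    partialDeriv_stereoFactor_zero]
  simp [roundJet]

theorem partialDeriv_partialDeriv_stereoMetric_zero (a b i j : Fin n) :
    partialDeriv a (fun y => partialDeriv b (fun x => stereoMetric x i j) y) 0
      = (roundJet n).2.2 a b i j := by
  rw [stereoMetric_apply]
  simp only [partialDeriv_const_mul _ _ (contDiff_stereoFactor.differentiable one_ne_zero _)]
  rw [partialDeriv_const_mul _ _ (differentiableAt_partialDeriv b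
      contDiff_stereoFactor.contDiffAt), partialDeriv_partialDeriv_stereoFactor_zero]
  simp only [roundJet]
  split_ifs <;> simp

/-- The coordinate vectors have norm one, so the operator norm bounds the partial derivatives. -/
theorem abs_partialDeriv_sub_le {f g : EuclideanSpace ℝ (Fin n) → ℝ}
    {x : EuclideanSpace ℝ (Fin n)} (hf : ContDiffAt ℝ 2 f x) (hg : ContDiffAt ℝ 2 g x)
    (a : Fin n) : |partialDeriv a f x - partialDeriv a g x|
      ≤ ‖iteratedFDeriv ℝ 1 (fun y => f y - g y) x‖ := by
  rw [← partialDeriv_fun_sub _ (hf.differentiableAt two_ne_zero) (hg.differentiableAt two_ne_zero),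
    norm_iteratedFDeriv_one, partialDeriv, ← Real.norm_eq_abs]
  simpa using (fderiv ℝ (fun y => f y - g y) x).le_opNorm (EuclideanSpace.single a 1)

theorem abs_partialDeriv_partialDeriv_sub_le {f g : EuclideanSpace ℝ (Fin n) → ℝ}
    {x : EuclideanSpace ℝ (Fin n)} (hf : ContDiffAt ℝ 2 f x) (hg : ContDiffAt ℝ 2 g x)
    (a b : Fin n) :
    |partialDeriv a (fun y => partialDeriv b f y) x
        - partialDeriv a (fun y => partialDeriv b g y) x|
      ≤ ‖iteratedFDeriv ℝ 2 (fun y => f y - g y) x‖ := by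
  have key : ∀ {h : EuclideanSpace ℝ (Fin n) → ℝ}, ContDiffAt ℝ 2 h x →
      partialDeriv a (fun y => partialDeriv b h y) x
        = iteratedFDeriv ℝ 2 h x ![EuclideanSpace.single a 1, EuclideanSpace.single b 1] :=
    fun {h} hh => by
      rw [partialDeriv_partialDeriv _ hh, iteratedFDeriv_two_apply]
      rfl
  have hsub : iteratedFDeriv ℝ 2 (fun y => f y - g y) x
      = iteratedFDeriv ℝ 2 f x - iteratedFDeriv ℝ 2 g x := iteratedFDeriv_sub_apply hf hg
  rw [key hf, key hg, ← sub_apply, ← hsub, ← Real.norm_eq_abs]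
  refine (ContinuousMultilinearMap.le_opNorm _ _).trans ?_
  simp [Fin.prod_univ_two]

/-- `C²`-closeness to the round metric at the origin of a stereographic chart makes the Bochner
form positive. -/
theorem exists_bochnerForm_pos_of_C2_close (hn : 3 ≤ n) :
    ∃ ε : ℝ, 0 < ε ∧ ∀ G : EuclideanSpace ℝ (Fin n) → Matrix (Fin n) (Fin n) ℝ,
      (∀ i j, ContDiffAt ℝ 2 (fun y => G y i j) 0) →
      (∀ i j, ∀ m ≤ 2, ‖iteratedFDeriv ℝ m (fun y => G y i j - stereoMetric y i j) 0‖ < ε) →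
      ∀ u : FormJet n, u ≠ 0 → 0 < bochnerForm (metricJet G 0) u := by
  obtain ⟨ε, hε, h⟩ := exists_bochnerForm_pos_of_close hn
  refine ⟨ε, hε, fun G hG hc => h G 0 (fun i j => ?_) (fun a i j => ?_) fun a b i j => ?_⟩
  · have := hc i j 0 (by norm_num)
    rwa [norm_iteratedFDeriv_zero, Real.norm_eq_abs, stereoMetric_zero_apply] at this
  · rw [← partialDeriv_stereoMetric_zero]
    exact (abs_partialDeriv_sub_le (hG i j) (contDiff_stereoMetric i j).contDiffAt a).trans_lt
      (hc i j 1 (by norm_num))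
  · rw [← partialDeriv_partialDeriv_stereoMetric_zero]
    exact (abs_partialDeriv_partialDeriv_sub_le (hG i j)
      (contDiff_stereoMetric i j).contDiffAt a b).trans_lt (hc i j 2 le_rfl)

end ChartCalculus

/-! ### Components of tensors in charts -/

section Coordinates

variable {n : ℕ} {M : Type*} [TopologicalSpace M]
  [ChartedSpace (EuclideanSpace ℝ (Fin n)) M] [IsManifold (𝓡 n) ∞ M]

theorem mvfderiv_extChartAt_coordVec {q : M} {x : EuclideanSpace ℝ (Fin n)}
    (hx : x ∈ (extChartAt (𝓡 n) q).target) (v : EuclideanSpace ℝ (Fin n)) :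
    mvfderiv (𝓡 n) (extChartAt (𝓡 n) q) ((extChartAt (𝓡 n) q).symm x)
      (mfderiv 𝓘(ℝ, EuclideanSpace ℝ (Fin n)) (𝓡 n) (extChartAt (𝓡 n) q).symm x v) = v := by
  have h := mfderiv_extChartAt_comp_mfderivWithin_extChartAt_symm (I := 𝓡 n) hx
  rw [ModelWithCorners.range_eq_univ, mfderivWithin_univ] at h
  exact congrArg (fun f : EuclideanSpace ℝ (Fin n) →L[ℝ] EuclideanSpace ℝ (Fin n) => f v) h

theorem mfderiv_extChartAt_symm_mvfderiv {q : M} {x : EuclideanSpace ℝ (Fin n)}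
    (hx : x ∈ (extChartAt (𝓡 n) q).target)
    (u : TangentSpace (𝓡 n) ((extChartAt (𝓡 n) q).symm x)) :
    mfderiv 𝓘(ℝ, EuclideanSpace ℝ (Fin n)) (𝓡 n) (extChartAt (𝓡 n) q).symm x
      (mvfderiv (𝓡 n) (extChartAt (𝓡 n) q) ((extChartAt (𝓡 n) q).symm x) u) = u := by
  have h := mfderivWithin_extChartAt_symm_comp_mfderiv_extChartAt (I := 𝓡 n) hx
  rw [ModelWithCorners.range_eq_univ, mfderivWithin_univ] at h
  exact congrArg (fun f : EuclideanSpace ℝ (Fin n) →L[ℝ] EuclideanSpace ℝ (Fin n) => f u) h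

theorem symmL_trivializationAt_extChartAt_symm {q : M} {x : EuclideanSpace ℝ (Fin n)}
    (hx : x ∈ (extChartAt (𝓡 n) q).target) (v : EuclideanSpace ℝ (Fin n)) :
    (trivializationAt (EuclideanSpace ℝ (Fin n)) (TangentSpace (𝓡 n) : M → Type) q).symmL ℝ
        ((extChartAt (𝓡 n) q).symm x) v
      = mfderiv 𝓘(ℝ, EuclideanSpace ℝ (Fin n)) (𝓡 n) (extChartAt (𝓡 n) q).symm x v := by
  have hp : (extChartAt (𝓡 n) q).symm x ∈ (chartAt (EuclideanSpace ℝ (Fin n)) q).source := by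
    rw [← extChartAt_source (I := 𝓡 n)]
    exact (extChartAt (𝓡 n) q).map_target hx
  have h := TangentBundle.symmL_trivializationAt (I := 𝓡 n) hp
  rw [ModelWithCorners.range_eq_univ, mfderivWithin_univ] at h
  refine (congrArg (fun f : EuclideanSpace ℝ (Fin n) →L[ℝ] EuclideanSpace ℝ (Fin n) => f v)
    h).trans ?_
  exact congrArg (fun z => (mfderiv 𝓘(ℝ, EuclideanSpace ℝ (Fin n)) (𝓡 n)
    (extChartAt (𝓡 n) q).symm z : EuclideanSpace ℝ (Fin n) →L[ℝ] EuclideanSpace ℝ (Fin n)) v)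
    ((extChartAt (𝓡 n) q).right_inv hx)

/-- Smoothness of `J` is stated through trivializations of the bundle; this identification passes it
on to the components. -/
theorem structureCoord_eq_trivializationAt (J : AlmostComplexStructure n M) {q : M}
    {x : EuclideanSpace ℝ (Fin n)} (hx : x ∈ (extChartAt (𝓡 n) q).target) (i : Fin 1 → Fin n)
    (k : Fin n) :
    structureCoord J q i k x
      = (trivializationAt (EuclideanSpace ℝ (Fin n) →L[ℝ] EuclideanSpace ℝ (Fin n))
          (fun p : M => TangentSpace (𝓡 n) p →L[ℝ] TangentSpace (𝓡 n) p) q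
          ⟨(extChartAt (𝓡 n) q).symm x, J.toFun ((extChartAt (𝓡 n) q).symm x)⟩).2
        (EuclideanSpace.single (i 0) 1) k := by
  have hp : (extChartAt (𝓡 n) q).symm x ∈ (chartAt (EuclideanSpace ℝ (Fin n)) q).source := by
    rw [← extChartAt_source (I := 𝓡 n)]
    exact (extChartAt (𝓡 n) q).map_target hx
  rw [hom_trivializationAt_apply]
  simp only [ContinuousLinearMap.inCoordinates, ContinuousLinearMap.coe_comp, Function.comp_apply]
  rw [symmL_trivializationAt_extChartAt_symm hx,
    TangentBundle.continuousLinearMapAt_trivializationAt hp]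
  rfl

theorem metricCoord_eq_trivializationAt (g : SmoothMetric n M) {q : M}
    {x : EuclideanSpace ℝ (Fin n)} (hx : x ∈ (extChartAt (𝓡 n) q).target) (i j : Fin n) :
    metricCoord g q x i j
      = (trivializationAt (EuclideanSpace ℝ (Fin n) →L[ℝ] EuclideanSpace ℝ (Fin n) →L[ℝ] ℝ)
          (fun p : M => TangentSpace (𝓡 n) p →L[ℝ] TangentSpace (𝓡 n) p →L[ℝ] ℝ) q
          ⟨(extChartAt (𝓡 n) q).symm x, g.inner ((extChartAt (𝓡 n) q).symm x)⟩).2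
        (EuclideanSpace.single i 1) (EuclideanSpace.single j 1) := by
  have hp : (extChartAt (𝓡 n) q).symm x ∈ (chartAt (EuclideanSpace ℝ (Fin n)) q).source := by
    rw [← extChartAt_source (I := 𝓡 n)]
    exact (extChartAt (𝓡 n) q).map_target hx
  have hb' : (extChartAt (𝓡 n) q).symm x ∈
      (trivializationAt (EuclideanSpace ℝ (Fin n) →L[ℝ] ℝ)
      (fun p : M => TangentSpace (𝓡 n) p →L[ℝ] ℝ) q).baseSet := by
    simpa [hom_trivializationAt_baseSet] using hp
  simp only [hom_trivializationAt_apply, ContinuousLinearMap.inCoordinates,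
    ContinuousLinearMap.coe_comp, Function.comp_apply,
    Trivialization.continuousLinearMapAt_apply, Trivialization.coe_linearMapAt_of_mem _ hb']
  simp only [symmL_trivializationAt_extChartAt_symm hx]
  have h : metricCoord g q x i j = g.inner ((extChartAt (𝓡 n) q).symm x)
    (mfderiv 𝓘(ℝ, EuclideanSpace ℝ (Fin n)) (𝓡 n) (extChartAt (𝓡 n) q).symm x
      (EuclideanSpace.single i 1))
    (mfderiv 𝓘(ℝ, EuclideanSpace ℝ (Fin n)) (𝓡 n) (extChartAt (𝓡 n) q).symm x
      (EuclideanSpace.single j 1)) := rfl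
  rw [h]
  simp

theorem contMDiffAt_extChartAt_symm_self (q : M) :
    ContMDiffAt 𝓘(ℝ, EuclideanSpace ℝ (Fin n)) (𝓡 n) ∞ (extChartAt (𝓡 n) q).symm
      (extChartAt (𝓡 n) q q) :=
  (contMDiffOn_extChartAt_symm q).contMDiffAt (extChartAt_target_mem_nhds q)

theorem contDiffAt_structureCoord (J : AlmostComplexStructure n M) (q : M) (i : Fin 1 → Fin n)
    (k : Fin n) : ContDiffAt ℝ 2 (structureCoord J q i k) (extChartAt (𝓡 n) q q) := by
  have h1 := (contMDiffAt_section q).1 (J.contMDiff q)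
  have h2 := h1.comp_of_eq (contMDiffAt_extChartAt_symm_self q) (extChartAt_to_inv q)
  have h3 := (contMDiffAt_iff_contDiffAt.1 h2).of_le (m := 2) (WithTop.coe_le_coe.2 le_top)
  have h4 := (EuclideanSpace.proj k : EuclideanSpace ℝ (Fin n) →L[ℝ] ℝ).contDiff.contDiffAt.comp
    (extChartAt (𝓡 n) q q) (h3.clm_apply (contDiffAt_const (c := EuclideanSpace.single (i 0) 1)))
  refine h4.congr_of_eventuallyEq ?_
  filter_upwards [extChartAt_target_mem_nhds (I := 𝓡 n) q] with x hx
  exact structureCoord_eq_trivializationAt J hx i k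

theorem contDiffAt_metricCoord (g : SmoothMetric n M) (q : M) (i j : Fin n) :
    ContDiffAt ℝ 2 (fun x => metricCoord g q x i j) (extChartAt (𝓡 n) q q) := by
  have h1 := (contMDiffAt_section q).1 (g.contMDiff q)
  have h2 := h1.comp_of_eq (contMDiffAt_extChartAt_symm_self q) (extChartAt_to_inv q)
  have h3 := (contMDiffAt_iff_contDiffAt.1 h2).of_le (m := 2) (WithTop.coe_le_coe.2 le_top)
  have h4 := (h3.clm_apply (contDiffAt_const (c := EuclideanSpace.single i 1))).clm_apply
    (contDiffAt_const (c := EuclideanSpace.single j 1))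
  refine h4.congr_of_eventuallyEq ?_
  filter_upwards [extChartAt_target_mem_nhds (I := 𝓡 n) q] with x hx
  exact metricCoord_eq_trivializationAt g hx i j

/-- The differential of the inverse chart has a left inverse, so a nonzero `v` gives a nonzero
tangent vector, whose `g`-square is positive. -/
theorem posDef_metricCoord (g : SmoothMetric n M) {q : M} {x : EuclideanSpace ℝ (Fin n)}
    (hx : x ∈ (extChartAt (𝓡 n) q).target) : (metricCoord g q x).PosDef := by
  refine Matrix.PosDef.of_dotProduct_mulVec_pos ?_ fun v hv => ?_
  · ext i j
    exact g.symm _ _ _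
  · set w : EuclideanSpace ℝ (Fin n) := ∑ i, v i • EuclideanSpace.single i (1 : ℝ) with hw
    have hw0 : w ≠ 0 := fun h => hv <| by
      funext i
      have := congrArg (fun z : EuclideanSpace ℝ (Fin n) => z i) h
      simpa [hw, Finset.sum_apply, Pi.single_apply] using this
    set C : EuclideanSpace ℝ (Fin n) →L[ℝ] TangentSpace (𝓡 n) ((extChartAt (𝓡 n) q).symm x) :=
      mfderiv 𝓘(ℝ, EuclideanSpace ℝ (Fin n)) (𝓡 n) (extChartAt (𝓡 n) q).symm x with hC
    have hCw : C w ≠ 0 := fun h => hw0 <| by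
      rw [← mvfderiv_extChartAt_coordVec hx w]
      exact (congrArg _ h).trans (map_zero _)
    have h1 : star v ⬝ᵥ Matrix.mulVec (metricCoord g q x) v
        = g.inner ((extChartAt (𝓡 n) q).symm x) (C w) (C w) := by
      simp only [hw, map_sum, map_smul, sum_apply, smul_apply, smul_eq_mul, dotProduct,
        Matrix.mulVec, star_trivial, Finset.mul_sum]
      rw [Finset.sum_comm]
      refine Finset.sum_congr rfl fun i _ => Finset.sum_congr rfl fun j _ => ?_
      have : metricCoord g q x j i = g.inner ((extChartAt (𝓡 n) q).symm x)
        (C (EuclideanSpace.single j 1)) (C (EuclideanSpace.single i 1)) := rfl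
      rw [this]
      ring
    rw [h1]
    exact g.pos _ _ hCw

end Coordinates

/-! ### Stereographic projection is conformal -/

section Stereographic

variable {E F : Type*} [NormedAddCommGroup E] [InnerProductSpace ℝ E] [NormedAddCommGroup F]
  [InnerProductSpace ℝ F]

/-- The inverse of stereographic projection from the point `v`, along a linear isometry `ι` onto
the orthogonal complement of `v`. -/
def stereoParam (ι : E →ₗᵢ[ℝ] F) (v : F) (x : E) : F :=
  (‖x‖ ^ 2 + 4)⁻¹ • ((4 : ℝ) • ι x + (‖x‖ ^ 2 - 4) • v)

theorem hasFDerivAt_stereoParam (ι : E →ₗᵢ[ℝ] F) (v : F) (x : E) :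
    ∃ L : E →L[ℝ] F, HasFDerivAt (stereoParam ι v) L x ∧ ∀ w, L w =
      (‖x‖ ^ 2 + 4)⁻¹ • ((4 : ℝ) • ι w + (2 * inner ℝ x w) • v)
        + (-(2 * inner ℝ x w) / (‖x‖ ^ 2 + 4) ^ 2) • ((4 : ℝ) • ι x + (‖x‖ ^ 2 - 4) • v) := by
  have hs : HasFDerivAt (fun y : E => ‖y‖ ^ 2) (2 • innerSL ℝ x) x :=
    (hasStrictFDerivAt_norm_sq x).hasFDerivAt
  have hne : ‖x‖ ^ 2 + 4 ≠ 0 := by positivity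
  have h1 := (hasDerivAt_inv hne).comp_hasFDerivAt x (hs.add_const 4)
  have h2 := (ι.toContinuousLinearMap.hasFDerivAt (x := x)).const_smul (4 : ℝ)
  have h3 := h2.add ((hs.sub_const 4).smul_const v)
  refine ⟨_, h1.smul h3, fun w => ?_⟩
  have hcoef : -(2 * inner ℝ x w) / (‖x‖ ^ 2 + 4) ^ 2
      = -((‖x‖ ^ 2 + 4) ^ 2)⁻¹ * (2 * inner ℝ x w) := by ring
  rw [hcoef]
  simp [two_mul]

/-- Since `ι` is isometric with image orthogonal to the unit vector `v`, all terms containing `⟪x,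
a⟫ ⟪x, b⟫` cancel. -/
theorem inner_fderiv_stereoParam (ι : E →ₗᵢ[ℝ] F) {v : F} (hv : ‖v‖ = 1)
    (hι : ∀ x, inner ℝ (ι x) v = 0) (x a b : E) :
    inner ℝ (fderiv ℝ (stereoParam ι v) x a) (fderiv ℝ (stereoParam ι v) x b)
      = 16 / (‖x‖ ^ 2 + 4) ^ 2 * inner ℝ a b := by
  obtain ⟨L, hL, hLw⟩ := hasFDerivAt_stereoParam ι v x
  have hvv : inner ℝ v v = (1 : ℝ) := by simp [hv]
  have hι' : ∀ x, inner ℝ v (ι x) = 0 := fun x => by rw [real_inner_comm, hι]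
  have hxx : inner ℝ x x = ‖x‖ ^ 2 := real_inner_self_eq_norm_sq x
  rw [hL.fderiv, hLw, hLw]
  simp only [inner_add_left, inner_add_right, real_inner_smul_left, real_inner_smul_right,
    ι.inner_map_map, hι, hι', hvv, hxx, real_inner_comm x a]
  have hne : ‖x‖ ^ 2 + 4 ≠ 0 := by positivity
  field_simp
  ring

end Stereographic

section Sphere

variable {n : ℕ}

/-- The stereographic charts of the sphere are parametrized by `stereoParam`. -/
theorem exists_coe_extChartAt_symm_eq (q : UnitSphere n) :
    ∃ ι : EuclideanSpace ℝ (Fin n) →ₗᵢ[ℝ] EuclideanSpace ℝ (Fin (n + 1)),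
      (∀ x, inner ℝ (ι x) (-(q : EuclideanSpace ℝ (Fin (n + 1)))) = 0) ∧
      (fun x => ((extChartAt (𝓡 n) q).symm x : EuclideanSpace ℝ (Fin (n + 1))))
        = stereoParam ι (-(q : EuclideanSpace ℝ (Fin (n + 1)))) := by
  have := Fact.mk (@finrank_euclideanSpace_fin ℝ _ (n + 1))
  let U := (OrthonormalBasis.fromOrthogonalSpanSingleton (𝕜 := ℝ) n
    (ne_zero_of_mem_unit_sphere (-q))).repr
  refine ⟨(Submodule.subtypeₗᵢ _).comp U.symm.toLinearIsometry, fun x => ?_, funext fun x => ?_⟩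
  · have h := (U.symm x).2
    rw [Submodule.mem_orthogonal_singleton_iff_inner_left] at h
    exact h
  · have h := stereographic'_symm_apply (n := n) (-q) x
    have hnorm : ‖(U.symm x : EuclideanSpace ℝ (Fin (n + 1)))‖ = ‖x‖ := by
      exact U.symm.norm_map x
    refine h.trans ?_
    change (‖(U.symm x : EuclideanSpace ℝ (Fin (n + 1)))‖ ^ 2 + 4)⁻¹ • (4 : ℝ) •
        (U.symm x : EuclideanSpace ℝ (Fin (n + 1)))
      + (‖(U.symm x : EuclideanSpace ℝ (Fin (n + 1)))‖ ^ 2 + 4)⁻¹ •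
        (‖(U.symm x : EuclideanSpace ℝ (Fin (n + 1)))‖ ^ 2 - 4) • _ = _
    rw [hnorm, stereoParam, smul_add]
    rfl

theorem extChartAt_sphere_target (q : UnitSphere n) : (extChartAt (𝓡 n) q).target = Set.univ := by
  have := Fact.mk (@finrank_euclideanSpace_fin ℝ _ (n + 1))
  rw [extChartAt_target]
  simp only [modelWithCornersSelf_coe_symm, modelWithCornersSelf_coe, Set.range_id, Set.inter_univ,
    Set.preimage_id]
  exact stereographic'_target (-q)

theorem extChartAt_sphere_self (q : UnitSphere n) : extChartAt (𝓡 n) q q = 0 := by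
  have := Fact.mk (@finrank_euclideanSpace_fin ℝ _ (n + 1))
  change (OrthonormalBasis.fromOrthogonalSpanSingleton (𝕜 := ℝ) n
    (ne_zero_of_mem_unit_sphere (-q))).repr (stereographic (norm_eq_of_mem_sphere (-q)) q) = 0
  rw [stereographic_neg_apply q, map_zero]

/-- The stereographic charts are conformal for the round metric. -/
theorem inner_sphereInclDeriv_mfderiv (q : UnitSphere n) (x v w : EuclideanSpace ℝ (Fin n)) :
    inner ℝ
      (sphereInclDeriv n ((extChartAt (𝓡 n) q).symm x)
        (mfderiv 𝓘(ℝ, EuclideanSpace ℝ (Fin n)) (𝓡 n) (extChartAt (𝓡 n) q).symm x v))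
      (sphereInclDeriv n ((extChartAt (𝓡 n) q).symm x)
        (mfderiv 𝓘(ℝ, EuclideanSpace ℝ (Fin n)) (𝓡 n) (extChartAt (𝓡 n) q).symm x w))
      = ChartCalculus.stereoFactor x * inner ℝ v w := by
  have := Fact.mk (@finrank_euclideanSpace_fin ℝ _ (n + 1))
  obtain ⟨ι, hι, he⟩ := exists_coe_extChartAt_symm_eq q
  have hq : ‖-(q : EuclideanSpace ℝ (Fin (n + 1)))‖ = 1 := by
    rw [norm_neg]
    exact norm_eq_of_mem_sphere q
  have hψ : MDifferentiableAt 𝓘(ℝ, EuclideanSpace ℝ (Fin n)) (𝓡 n) (extChartAt (𝓡 n) q).symm x :=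
    ((contMDiffOn_extChartAt_symm (n := 1) q).contMDiffAt
      (by rw [extChartAt_sphere_target]; exact Filter.univ_mem)).mdifferentiableAt one_ne_zero
  have hval : MDifferentiableAt (𝓡 n) 𝓘(ℝ, EuclideanSpace ℝ (Fin (n + 1)))
      (Subtype.val : UnitSphere n → EuclideanSpace ℝ (Fin (n + 1)))
      ((extChartAt (𝓡 n) q).symm x) :=
    (contMDiff_coe_sphere (m := 1) _).mdifferentiableAt one_ne_zero
  have key : ∀ u : EuclideanSpace ℝ (Fin n), sphereInclDeriv n ((extChartAt (𝓡 n) q).symm x)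
      (mfderiv 𝓘(ℝ, EuclideanSpace ℝ (Fin n)) (𝓡 n) (extChartAt (𝓡 n) q).symm x u)
      = fderiv ℝ (stereoParam ι (-(q : EuclideanSpace ℝ (Fin (n + 1))))) x u := fun u => by
    have h1 := mfderiv_comp x hval hψ
    have h2 : mfderiv 𝓘(ℝ, EuclideanSpace ℝ (Fin n)) 𝓘(ℝ, EuclideanSpace ℝ (Fin (n + 1)))
        (Subtype.val ∘ (extChartAt (𝓡 n) q).symm) x
        = fderiv ℝ (stereoParam ι (-(q : EuclideanSpace ℝ (Fin (n + 1))))) x := by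
      rw [mfderiv_eq_fderiv]
      exact congrArg (fun f => fderiv ℝ f x) he
    rw [h2] at h1
    exact (congrArg (fun f : EuclideanSpace ℝ (Fin n) →L[ℝ] EuclideanSpace ℝ (Fin (n + 1)) => f u)
      h1).symm
  rw [key, key, inner_fderiv_stereoParam ι hq hι]
  rfl

theorem metricCoord_roundMetric (q : UnitSphere n) (x : EuclideanSpace ℝ (Fin n)) :
    metricCoord (roundMetric n) q x = ChartCalculus.stereoMetric x := by
  ext i j
  refine (inner_sphereInclDeriv_mfderiv q x _ _).trans ?_
  simp [ChartCalculus.stereoMetric, Matrix.one_apply, EuclideanSpace.inner_single_left]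

/-! ### The norm of an almost complex structure -/

/-- The matrix of an endomorphism-valued form in a chart. -/
def structureMatrix (θ : ChartCalculus.VForm n 1) (x : EuclideanSpace ℝ (Fin n)) :
    Matrix (Fin n) (Fin n) ℝ :=
  Matrix.of fun k i => θ (fun _ => i) k x

theorem normSq_eq_trace (θ : ChartCalculus.VForm n 1) (x : EuclideanSpace ℝ (Fin n)) :
    ChartCalculus.normSq θ x = ((structureMatrix θ x).transpose * structureMatrix θ x).trace := by
  simp [ChartCalculus.normSq, structureMatrix, Matrix.trace, Matrix.mul_apply, sq]

/-- The Frobenius norm is invariant under conjugation by conformal matrices. -/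
theorem Matrix.trace_transpose_mul_self_eq_of_conformal {ι : Type*} [Fintype ι] [DecidableEq ι]
    {A B T : Matrix ι ι ℝ} {c : ℝ} (hc : c ≠ 0) (hT : T.transpose * T = c • 1)
    (h : T * A = B * T) : (A.transpose * A).trace = (B.transpose * B).trace := by
  -- For a square matrix the left inverse `c⁻¹ Tᵀ` is also a right inverse.
  have hT' : T * T.transpose = c • 1 := by
    have h1 : (c⁻¹ • T.transpose) * T = 1 := by
      rw [Matrix.smul_mul, hT, smul_smul, inv_mul_cancel₀ hc, one_smul]
    have h2 := mul_eq_one_comm.1 h1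
    rw [Matrix.mul_smul] at h2
    rw [← h2, smul_smul, mul_inv_cancel₀ hc, one_smul]
  have h3 : c • (A.transpose * A) = T.transpose * (B.transpose * B * T) := by
    have : A.transpose * (T.transpose * T) * A = (T * A).transpose * (T * A) := by
      simp only [Matrix.transpose_mul, Matrix.mul_assoc]
    rw [hT, Matrix.mul_smul, Matrix.smul_mul, Matrix.mul_one] at this
    rw [this, h, Matrix.transpose_mul]
    simp only [Matrix.mul_assoc]
  have h4 := congrArg Matrix.trace h3
  rw [Matrix.trace_mul_comm, Matrix.mul_assoc, hT', Matrix.trace_smul, Matrix.mul_smul,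
    Matrix.mul_one, Matrix.trace_smul] at h4
  exact mul_left_cancel₀ hc h4

/-- A stereographic chart gives a conformal frame at each of its points. -/
theorem exists_conformal_frame (q p : UnitSphere n) (x : EuclideanSpace ℝ (Fin n))
    (h : (extChartAt (𝓡 n) q).symm x = p) :
    ∃ (C : EuclideanSpace ℝ (Fin n) →L[ℝ] TangentSpace (𝓡 n) p)
      (D : TangentSpace (𝓡 n) p →L[ℝ] EuclideanSpace ℝ (Fin n)) (c : ℝ), c ≠ 0 ∧
      (∀ v, D (C v) = v) ∧ (∀ u, C (D u) = u) ∧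
      (∀ v w, inner ℝ (sphereInclDeriv n p (C v)) (sphereInclDeriv n p (C w)) = c * inner ℝ v w) ∧
      ∀ (J : AlmostComplexStructure n (UnitSphere n)) (i k : Fin n),
        structureCoord J q (fun _ => i) k x
          = D (J.toFun p (C (EuclideanSpace.single i 1))) k := by
  subst h
  have hx : x ∈ (extChartAt (𝓡 n) q).target := by rw [extChartAt_sphere_target]; trivial
  refine ⟨mfderiv 𝓘(ℝ, EuclideanSpace ℝ (Fin n)) (𝓡 n) (extChartAt (𝓡 n) q).symm x,
    mvfderiv (𝓡 n) (extChartAt (𝓡 n) q) ((extChartAt (𝓡 n) q).symm x),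
    ChartCalculus.stereoFactor x, ?_, mvfderiv_extChartAt_coordVec hx,
    mfderiv_extChartAt_symm_mvfderiv hx, inner_sphereInclDeriv_mfderiv q x, fun J i k => rfl⟩
  rw [ChartCalculus.stereoFactor]
  positivity

/-- The matrix of a linear map in the standard basis. -/
def stdMatrix (f : EuclideanSpace ℝ (Fin n) →L[ℝ] EuclideanSpace ℝ (Fin n)) :
    Matrix (Fin n) (Fin n) ℝ :=
  Matrix.of fun k i => f (EuclideanSpace.single i 1) k

theorem stdMatrix_comp (f g : EuclideanSpace ℝ (Fin n) →L[ℝ] EuclideanSpace ℝ (Fin n)) :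
    stdMatrix (f ∘L g) = stdMatrix f * stdMatrix g := by
  ext k i
  have h : g (EuclideanSpace.single i 1)
      = ∑ j, g (EuclideanSpace.single i 1) j • EuclideanSpace.single j (1 : ℝ) := by
    ext j
    simp [Finset.sum_apply, Pi.single_apply]
  simp only [stdMatrix, Matrix.mul_apply, Matrix.of_apply, ContinuousLinearMap.comp_apply]
  conv_lhs => rw [h]
  simp [mul_comm]

/-- The norm of an almost complex structure with respect to the round metric can be computed in
any stereographic chart. -/
theorem normSq_structureCoord_eq (J : AlmostComplexStructure n (UnitSphere n))
    {q q' : UnitSphere n} {x x' : EuclideanSpace ℝ (Fin n)}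
    (h : (extChartAt (𝓡 n) q).symm x = (extChartAt (𝓡 n) q').symm x') :
    ChartCalculus.normSq (structureCoord J q) x = ChartCalculus.normSq (structureCoord J q') x' := by
  obtain ⟨p, hp⟩ : ∃ p, (extChartAt (𝓡 n) q').symm x' = p := ⟨_, rfl⟩
  obtain ⟨C, D, c, hc, hDC, hCD, hin, hJ⟩ := exists_conformal_frame q p x (h.trans hp)
  obtain ⟨C', D', c', hc', hDC', hCD', hin', hJ'⟩ := exists_conformal_frame q' p x' hp
  rw [normSq_eq_trace, normSq_eq_trace]
  have hA : structureMatrix (structureCoord J q) x = stdMatrix (D ∘L (J.toFun p) ∘L C) := by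
    ext k i
    exact hJ J i k
  have hB : structureMatrix (structureCoord J q') x' = stdMatrix (D' ∘L (J.toFun p) ∘L C') := by
    ext k i
    exact hJ' J i k
  rw [hA, hB]
  -- `T` is the differential of the change of chart. Both frames scale the round inner product, by
  -- `c` and `c'`, so `Tᵀ T = (c / c') • 1`.
  refine Matrix.trace_transpose_mul_self_eq_of_conformal (T := stdMatrix (D' ∘L C))
    (c := c / c') (div_ne_zero hc hc') ?_ ?_
  · ext i j
    have h1 : c' * inner ℝ (D' (C (EuclideanSpace.single i 1))) (D' (C (EuclideanSpace.single j 1)))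
        = c * inner ℝ (EuclideanSpace.single i (1 : ℝ)) (EuclideanSpace.single j (1 : ℝ)) := by
      rw [← hin', hCD', hCD', hin]
    have h2 : ((stdMatrix (D' ∘L C)).transpose * stdMatrix (D' ∘L C)) i j
        = inner ℝ (D' (C (EuclideanSpace.single i 1))) (D' (C (EuclideanSpace.single j 1))) := by
      simp [Matrix.mul_apply, stdMatrix, PiLp.inner_apply, mul_comm]
    rw [h2, Matrix.smul_apply, smul_eq_mul, div_mul_eq_mul_div, eq_div_iff hc', mul_comm, h1]
    simp [Matrix.one_apply, EuclideanSpace.inner_single_left]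
  · rw [← stdMatrix_comp, ← stdMatrix_comp]
    congr 1
    ext1 v
    simp [hCD, hCD']

theorem structureMatrix_mul_self (J : AlmostComplexStructure n (UnitSphere n)) (q : UnitSphere n)
    (x : EuclideanSpace ℝ (Fin n)) :
    structureMatrix (structureCoord J q) x * structureMatrix (structureCoord J q) x = -1 := by
  obtain ⟨C, D, c, hc, hDC, hCD, hin, hJ⟩ := exists_conformal_frame q _ x rfl
  have hA : structureMatrix (structureCoord J q) x
      = stdMatrix (D ∘L (J.toFun ((extChartAt (𝓡 n) q).symm x)) ∘L C) := by
    ext k i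
    exact hJ J i k
  rw [hA, ← stdMatrix_comp]
  ext k i
  have h1 : (D ∘L (J.toFun ((extChartAt (𝓡 n) q).symm x)) ∘L C)
      ((D ∘L (J.toFun ((extChartAt (𝓡 n) q).symm x)) ∘L C) (EuclideanSpace.single i 1))
      = -EuclideanSpace.single i 1 := by
    simp only [ContinuousLinearMap.comp_apply, hCD, J.sq, map_neg, hDC]
  have h2 := congrArg (fun z : EuclideanSpace ℝ (Fin n) => z k) h1
  refine h2.trans ?_
  simp [Matrix.one_apply]

/-- The squared norm of an almost complex structure with respect to the round metric. -/
def roundNormSq (J : AlmostComplexStructure n (UnitSphere n)) (p : UnitSphere n) : ℝ :=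
  ChartCalculus.normSq (structureCoord J p) (extChartAt (𝓡 n) p p)

theorem roundNormSq_extChartAt_symm (J : AlmostComplexStructure n (UnitSphere n))
    (q : UnitSphere n) (x : EuclideanSpace ℝ (Fin n)) :
    roundNormSq J ((extChartAt (𝓡 n) q).symm x) = ChartCalculus.normSq (structureCoord J q) x :=
  normSq_structureCoord_eq J (extChartAt_to_inv _)

/-- The definition uses a different chart at each point; chart independence rewrites it near `q` as
`normSq` in the single chart at `q`. -/
theorem continuous_roundNormSq (J : AlmostComplexStructure n (UnitSphere n)) :
    Continuous (roundNormSq J) := by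
  refine continuous_iff_continuousAt.2 fun q => ?_
  have h1 : ContinuousAt (ChartCalculus.normSq (structureCoord J q)) (extChartAt (𝓡 n) q q) :=
    (ChartCalculus.contDiffAt_normSq fun i k => contDiffAt_structureCoord J q i k).continuousAt
  have h2 := ContinuousAt.comp h1 (continuousAt_extChartAt (I := 𝓡 n) q)
  refine h2.congr ?_
  filter_upwards [extChartAt_source_mem_nhds (I := 𝓡 n) q] with p hp
  rw [Function.comp_apply, ← roundNormSq_extChartAt_symm, (extChartAt (𝓡 n) q).left_inv hp]

/-- A maximum of the round norm exists by compactness, and the chart centred there places it at the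
origin, where the 2-jet of the metric is controlled. -/
theorem exists_isLocalMax_normSq (J : AlmostComplexStructure n (UnitSphere n)) :
    ∃ q : UnitSphere n, IsLocalMax (ChartCalculus.normSq (structureCoord J q)) 0 := by
  have : Nonempty (UnitSphere n) := ⟨⟨EuclideanSpace.single 0 1, by simp⟩⟩
  obtain ⟨q, -, hq⟩ := isCompact_univ.exists_isMaxOn Set.univ_nonempty
    (continuous_roundNormSq J).continuousOn
  refine ⟨q, Filter.Eventually.of_forall fun x => ?_⟩
  rw [← extChartAt_sphere_self q, ← roundNormSq_extChartAt_symm, ← roundNormSq_extChartAt_symm,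
    extChartAt_to_inv]
  exact hq (Set.mem_univ _)

/-! ### Conclusion on the sphere -/

/-- There is no harmonic complex structure for a metric that is `C²`-close to the round one. -/
theorem exists_forall_not_isHarmonicComplexStructure (hn : 3 ≤ n) :
    ∃ ε : ℝ, 0 < ε ∧ ∀ g : SmoothMetric n (UnitSphere n), IsC2CloseToRound ε g →
      ∀ J : AlmostComplexStructure n (UnitSphere n), ¬ IsHarmonicComplexStructure g J := by
  obtain ⟨ε, hε, h⟩ := ChartCalculus.exists_bochnerForm_pos_of_C2_close hn
  refine ⟨ε, hε, fun g hg J hJ => ?_⟩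
  obtain ⟨q, hq⟩ := exists_isLocalMax_normSq J
  have h0 := extChartAt_sphere_self q
  have hG : ∀ i j, ContDiffAt ℝ 2 (fun y => metricCoord g q y i j) 0 := fun i j =>
    h0 ▸ contDiffAt_metricCoord g q i j
  have hθ : ∀ i k, ContDiffAt ℝ 2 (structureCoord J q i k) 0 := fun i k =>
    h0 ▸ contDiffAt_structureCoord J q i k
  have hQ := h (metricCoord g q) hG fun i j m hm => by
    have := hg q i j m hm
    rw [h0] at this
    simpa only [metricCoord_roundMetric] using this
  have hsq := structureMatrix_mul_self J q 0
  have htr : (structureMatrix (structureCoord J q) 0).trace = 0 :=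
    Matrix.trace_eq_zero_of_mul_self_eq_neg_one hsq
  -- A vanishing jet would make the matrix of `J` zero, against `J² = -1`; comparing a diagonal
  -- entry requires `n > 0`.
  have hne : ChartCalculus.formJet (structureCoord J q) 0 ≠ 0 := fun h1 => by
    have h2 : structureMatrix (structureCoord J q) 0 = 0 := by
      ext k i
      exact congrFun (congrFun (congrArg Prod.fst h1) i) k
    rw [h2, zero_mul] at hsq
    have := congrFun (congrFun hsq ⟨0, by omega⟩) ⟨0, by omega⟩
    simp at this
  obtain ⟨i, k, hik⟩ := ChartCalculus.exists_hodgeLaplace_ne_zero hG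
    (posDef_metricCoord g (by rw [extChartAt_sphere_target]; trivial)) hθ hq
    htr hne hQ
  have := hJ q i k
  rw [h0] at this
  exact hik this

theorem isC2CloseToRound_roundMetric {ε : ℝ} (hε : 0 < ε) :
    IsC2CloseToRound ε (roundMetric n) := fun q i j m _ => by
  have h : (fun x => metricCoord (roundMetric n) q x i j - metricCoord (roundMetric n) q x i j)
      = fun _ => (0 : ℝ) := funext fun x => sub_self _
  rw [h, iteratedFDeriv_fun_zero]
  simpa using hε

end Sphere
end

/-- The round metric lies in every `ε`-ball around itself, so the first claim is a case of the
second. -/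
theorem theorem4p2 :
    (∀ J : AlmostComplexStructure 6 (UnitSphere 6),
      ¬ IsHarmonicComplexStructure (roundMetric 6) J) ∧
    ∃ ε : ℝ, 0 < ε ∧ ∀ g : SmoothMetric 6 (UnitSphere 6), IsC2CloseToRound ε g →
      ∀ J : AlmostComplexStructure 6 (UnitSphere 6), ¬ IsHarmonicComplexStructure g J := by
  obtain ⟨ε, hε, h⟩ := exists_forall_not_isHarmonicComplexStructure (n := 6) (by norm_num)
  exact ⟨h _ (isC2CloseToRound_roundMetric hε), ε, hε, h⟩
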